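/- Let $0\le k<n$ be integers. Equip $\mathbb{R}^n$ with the distance of the infinity norm. For $x\in\mathbb{R}^n$ and $r>0$ let $S_k^j(x,r)$, $j=1,\dots,N=\binom{n}{k}2^{n-k}$, be the $k$-dimensional faces of the axes-parallel cube $x+[-r,r]^n$ (so the side length is $2r$), and let $S_{k,\delta}^j(x,r)$ be the open $\delta$-neighbourhood of $S_k^j(x,r)$. For $0<\delta<1$ and $f\in L^1_{\mathrm{loc}}(\mathbb{R}^n)$ define the $k$-skeleton maximal function $$M^k_\delta f(x)=\sup_{1\le r\le 2}\ \min_{1\le j\le N}\ \frac{1}{\mathcal{L}_n(S_{k,\delta}^j(x,r))}\int_{S_{k,\delta}^j(x,r)}|f(y)|\,dy,$$ where $\mathcal{L}_n$ is Lebesgue measure, and for $1\le p<\infty$ put $$\|M^k_\delta\|_{L^p\to L^p}=\sup_{f\in L^p(\mathbb{R}^n),\ f\ne 0}\frac{\|M^k_\delta f\|_{L^p(\mathbb{R}^n)}}{\|f\|_{L^p(\mathbb{R}^n)}}.$$ Then there is a constant $C(n,k)>0$ depending only on $n,k$, and for every $\varepsilon>0$ there is a constant $C'(n,k,\varepsilon)>0$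 depending only on $n,k,\varepsilon$, such that for all $1\le p<\infty$ and all $\delta\in(0,1)$ $$C'(n,k,\varepsilon)\cdot\delta^{\frac{k-n}{2np}+\varepsilon}\ \le\ \|M^k_\delta\|_{L^p\to L^p}\ \le\ C(n,k)\cdot\delta^{\frac{k-n}{2np}}.$$ -/

import Mathlib

open MeasureTheory Set
open scoped ENNReal

namespace SkeletonMaximal

/-- The `k`-dimensional faces of an axes-parallel cube in `ℝⁿ`: in each coordinate direction `i`
a face is either full (`c i = 0`) or sits at the lower or upper end (`c i = -1` or `c i = 1`),
and exactly `k` directions are full. -/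
abbrev FaceIndex (n k : ℕ) : Type :=
  {c : Fin n → SignType // (Finset.univ.filter fun i => c i = 0).card = k}

/-- The face with index `j` of the cube `x + [-r, r]ⁿ` (centre `x`, side length `2 * r`). -/
def face {n k : ℕ} (j : FaceIndex n k) (x : Fin n → ℝ) (r : ℝ) : Set (Fin n → ℝ) :=
  Set.univ.pi fun i => if j.1 i = 0 then Icc (x i - r) (x i + r) else {x i + (j.1 i : ℝ) * r}

/-- The open `δ`-neighbourhood of a face; the distance on `Fin n → ℝ` is the sup distance. -/
def faceNbhd {n k : ℕ} (δ : ℝ) (j : FaceIndex n k) (x : Fin n → ℝ) (r : ℝ) : Set (Fin n → ℝ) :=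
  Metric.thickening δ (face j x r)

/-- The average of `|f|` over the `δ`-neighbourhood of a face, with values in `[0, ∞]`. -/
noncomputable def faceAverage {n k : ℕ} (δ : ℝ) (f : (Fin n → ℝ) → ℝ) (j : FaceIndex n k)
    (x : Fin n → ℝ) (r : ℝ) : ℝ≥0∞ :=
  (∫⁻ y in faceNbhd δ j x r, ‖f y‖ₑ) / volume (faceNbhd δ j x r)

/-- The `k`-skeleton maximal function with width `δ`: the supremum over `1 ≤ r ≤ 2` of the minimum
over the (finitely many) `k`-faces of `x + [-r, r]ⁿ` of the average of `|f|` over the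
`δ`-neighbourhood of the face. -/
noncomputable def skeletonMaximal (n k : ℕ) (δ : ℝ) (f : (Fin n → ℝ) → ℝ) (x : Fin n → ℝ) :
    ℝ≥0∞ :=
  ⨆ r ∈ Icc (1 : ℝ) 2, ⨅ j : FaceIndex n k, faceAverage δ f j x r

/-- The `L^p → L^p` norm of the `k`-skeleton maximal operator, with values in `[0, ∞]`: the
supremum of `‖M f‖_p / ‖f‖_p` over all nonzero `f` in `L^p(ℝⁿ)`. -/
noncomputable def skeletonMaximalNorm (n k : ℕ) (δ : ℝ) (p : ℝ≥0∞) : ℝ≥0∞ :=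
  ⨆ (f : (Fin n → ℝ) → ℝ) (_ : MemLp f p volume) (_ : eLpNorm f p volume ≠ 0),
    eLpNorm (skeletonMaximal n k δ f) p volume / eLpNorm f p volume

end SkeletonMaximal

/-! Upper bound. By Jensen, `M(f)^p ≤ M(|f|^p)`, so the case `p = 1` suffices, and it localises to
unit cubes. Put `d = n - k`. If every face average at radius `r` is at least `m`, then for each sign
vector `σ` and each `d`-set `J` of coordinates, `m` is at most `δ^(-d)` times the mass of the slab
of width `~δ` in the `J`-coordinates about the corner `x + rσ`. Multiplying over the `n` cyclic
intervals `J` gives `m^(n/d) ≤ δ^(-n) G(x + rσ)`, where `∫ G ≲ (δ^d ∫ f)^(n/d)` by Finner's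
inequality. Faces are thereby replaced by corners. Opposite corners, averaged over radii within `δ`
of `r`, bound `m^(2n/d)` by `δ^(-2n-1) ∫ G(x + rσ) G(x - rσ) dr`. This is used along `n` independent
diagonals, made coordinate axes by a linear map. With `P i` the pair integral and `L i` the line
integral of `G`, one has `∫ P i / L i ≤ ∫ G`, and Loomis–Whitney controls `∏ L i ^ (1/(n-1))`.
Hölder yields `∫ ∏ P i ^ (1/(2n-1)) ≲ (∫ G)^(2n/(2n-1))`, and Jensen on the unit cube gives the
power `δ^(-d/(2n))`. Lower bound. With `b = δ^(1/(2n))`, one radius can place all `2n` numbers `x i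
± r` near lattices `b^l ℤ`, one scale each, with error `b^(l+1)`. Thus a set of measure `≲ b^d`
contains the `δ`-skeleton of some cube about every point of the unit cube; its indicator is the test
function. -/

namespace SkeletonMaximal

/-! ### Finner's inequality -/

/-- Finner's inequality for partial integrals: if `f a` depends only on the coordinates in `J a`
and every coordinate is covered with total weight one, then Hölder's inequality may be applied
one coordinate at a time. -/
theorem lmarginal_prod_rpow_le {ι α : Type*} [Fintype ι] [DecidableEq ι] [Fintype α]
    {f : α → (ι → ℝ) → ℝ≥0∞} (hf : ∀ a, Measurable (f a)) (J : α → Finset ι)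
    (hJ : ∀ a, ∀ i ∉ J a, ∀ x t, f a (Function.update x i t) = f a x)
    {θ : α → ℝ} (hθ0 : ∀ a, 0 ≤ θ a)
    (hθ : ∀ i, ∑ a ∈ Finset.univ.filter (fun a => i ∈ J a), θ a = 1)
    (s : Finset ι) (x : ι → ℝ) :
    (∫⋯∫⁻_s, (fun x => ∏ a, f a x ^ θ a) ∂(fun _ => volume)) x ≤
      ∏ a, ((∫⋯∫⁻_(s ∩ J a), f a ∂(fun _ => volume)) x) ^ θ a := by
  induction s using Finset.induction generalizing x with
  | empty => simp
  | insert i s hi ih =>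
    have hm : Measurable fun x => ∏ a, f a x ^ θ a :=
      Finset.measurable_prod _ fun a _ => (hf a).pow_const _
    rw [lmarginal_insert _ hm hi]
    refine (lintegral_mono fun t => ih _).trans ?_
    -- Factors with `i ∉ J a` are constant in the new variable and leave the integral; the others
    -- have weights summing to one, so Hölder applies to them.
    have hsplit : ∀ t, ∏ a, ((∫⋯∫⁻_(s ∩ J a), f a ∂(fun _ => volume))
          (Function.update x i t)) ^ θ a =
        (∏ a ∈ Finset.univ.filter (fun a => i ∈ J a),
          ((∫⋯∫⁻_(s ∩ J a), f a ∂(fun _ => volume)) (Function.update x i t)) ^ θ a) *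
        ∏ a ∈ Finset.univ.filter (fun a => i ∉ J a),
          ((∫⋯∫⁻_(insert i s ∩ J a), f a ∂(fun _ => volume)) x) ^ θ a := by
      intro t
      rw [← Finset.prod_filter_mul_prod_filter_not Finset.univ (fun a => i ∈ J a)]
      congr 1
      refine Finset.prod_congr rfl fun a ha => ?_
      have ha' : i ∉ J a := by simpa using ha
      rw [Finset.insert_inter_of_notMem ha', lmarginal_update_of_notMem (hf a) (by simp [hi])]
      congr 2
      funext y
      exact hJ a i ha' y t
    simp_rw [hsplit]
    have hmm : ∀ a, Measurable fun t => (∫⋯∫⁻_(s ∩ J a), f a ∂(fun _ => volume))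
        (Function.update x i t) := fun a =>
      ((hf a).lmarginal _).comp (measurable_update x)
    rw [lintegral_mul_const _ (Finset.measurable_prod _ fun a _ => (hmm a).pow_const _),
      ← Finset.prod_filter_mul_prod_filter_not Finset.univ (fun a => i ∈ J a)]
    gcongr
    refine (ENNReal.lintegral_prod_norm_pow_le _ (fun a _ => (hmm a).aemeasurable) (hθ i)
      fun a _ => hθ0 a).trans_eq ?_
    refine Finset.prod_congr rfl fun a ha => ?_
    have ha' : i ∈ J a := by simpa using ha
    rw [Finset.insert_inter_of_mem ha', lmarginal_insert _ (hf a) (by simp [hi])]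

/-- Finner's inequality. -/
theorem lintegral_prod_rpow_le {ι α : Type*} [Fintype ι] [DecidableEq ι] [Fintype α]
    {f : α → (ι → ℝ) → ℝ≥0∞} (hf : ∀ a, Measurable (f a)) (J : α → Finset ι)
    (hJ : ∀ a, ∀ i ∉ J a, ∀ x t, f a (Function.update x i t) = f a x)
    {θ : α → ℝ} (hθ0 : ∀ a, 0 ≤ θ a)
    (hθ : ∀ i, ∑ a ∈ Finset.univ.filter (fun a => i ∈ J a), θ a = 1) (x : ι → ℝ) :
    ∫⁻ x, ∏ a, f a x ^ θ a ≤ ∏ a, ((∫⋯∫⁻_(J a), f a ∂(fun _ => volume)) x) ^ θ a := by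
  have := lmarginal_prod_rpow_le hf J hJ hθ0 hθ Finset.univ x
  rw [← lintegral_eq_lmarginal_univ] at this
  rw [volume_pi]
  simpa only [Finset.univ_inter] using this

/-! ### Symmetric pairs of points on lines -/

/-- The integral of the convolution-type square `∫ g (x + r) g (x - r) dr`. -/
theorem lintegral_lintegral_add_mul_sub_le {g : ℝ → ℝ≥0∞} (hg : Measurable g) :
    ∫⁻ x, ∫⁻ r, g (x + r) * g (x - r) ≤ (∫⁻ x, g x) ^ 2 := by
  rw [lintegral_lintegral_swap (by fun_prop)]
  have h1 : ∀ r, ∫⁻ x, g (x + r) * g (x - r) = ∫⁻ x, g x * g (x - 2 * r) := by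
    intro r
    rw [← lintegral_add_right_eq_self (fun x => g x * g (x - 2 * r)) r]
    congr! 4
    ring
  simp_rw [h1]
  rw [lintegral_lintegral_swap (by fun_prop)]
  have h2 : ∀ x, ∫⁻ r, g (x - 2 * r) ≤ ∫⁻ x, g x := by
    intro x
    have := lintegral_map (μ := (volume : Measure ℝ)) hg
      (show Measurable fun r : ℝ => x - 2 * r by fun_prop)
    -- The Jacobian factor `1/2` is simply discarded.
    have e : Measure.map (fun r : ℝ => x - 2 * r) volume = ENNReal.ofReal 2⁻¹ • volume := by
      have e1 : (fun r : ℝ => x - 2 * r) = (fun y => x + y) ∘ fun r => (-2) * r := by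
        funext r; simp; ring
      rw [e1, ← Measure.map_map (by fun_prop) (by fun_prop),
        Real.map_volume_mul_left (by norm_num), Measure.map_smul, map_add_left_eq_self]
      norm_num
    rw [← this, e, lintegral_smul_measure]
    refine mul_le_of_le_one_left' ?_
    rw [ENNReal.ofReal_le_one]; norm_num
  calc ∫⁻ x, ∫⁻ r, g x * g (x - 2 * r) = ∫⁻ x, g x * ∫⁻ r, g (x - 2 * r) := by
        congr! 2 with x
        rw [lintegral_const_mul _ (by fun_prop)]
    _ ≤ ∫⁻ x, g x * ∫⁻ x, g x := by
        exact lintegral_mono fun x => mul_le_mul_right (h2 x) _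
    _ = (∫⁻ x, g x) ^ 2 := by
        rw [lintegral_mul_const _ hg, sq]

theorem rpow_le_div_rpow_mul {a b : ℝ≥0∞} {p : ℝ} (hp : 0 ≤ p) (hb : b ≠ ∞) (h : b = 0 → a = 0) :
    a ^ p ≤ (a / b) ^ p * b ^ p := by
  rw [← ENNReal.mul_rpow_of_nonneg _ _ hp]
  rcases eq_or_ne b 0 with hb0 | hb0
  · simp [h hb0, hb0]
  · rw [ENNReal.div_mul_cancel hb0 hb]

/-- The estimate for symmetric pairs of points on axes-parallel lines. -/
theorem lintegral_prod_line_pairs_le {n : ℕ} (hn : 0 < n) {G : (Fin n → ℝ) → ℝ≥0∞}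
    (hG : Measurable G) (hfin : ∀ x i, ∫⁻ t, G (Function.update x i t) ≠ ∞) :
    ∫⁻ x, ∏ i, (∫⁻ r, G (Function.update x i (x i + r)) * G (Function.update x i (x i - r))) ^
        ((1 : ℝ) / (2 * n - 1)) ≤ (∫⁻ x, G x) ^ ((2 * n : ℝ) / (2 * n - 1)) := by
  set L : Fin n → (Fin n → ℝ) → ℝ≥0∞ := fun i x => ∫⁻ t, G (Function.update x i t) with hL
  set P : Fin n → (Fin n → ℝ) → ℝ≥0∞ := fun i x =>
    ∫⁻ r, G (Function.update x i (x i + r)) * G (Function.update x i (x i - r)) with hP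
  have hupd : ∀ i, Measurable fun q : (Fin n → ℝ) × ℝ => Function.update q.1 i q.2 :=
    fun i => measurable_update'
  have hLm : ∀ i, Measurable (L i) := fun i =>
    Measurable.lintegral_prod_right' (f := fun q : (Fin n → ℝ) × ℝ => G (Function.update q.1 i q.2))
      (hG.comp (hupd i))
  have hPm : ∀ i, Measurable (P i) := fun i =>
    Measurable.lintegral_prod_right' (f := fun q : (Fin n → ℝ) × ℝ =>
      G (Function.update q.1 i (q.1 i + q.2)) * G (Function.update q.1 i (q.1 i - q.2)))
      ((hG.comp ((hupd i).comp (f := fun q : (Fin n → ℝ) × ℝ => (q.1, q.1 i + q.2))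
        (by fun_prop))).mul
       (hG.comp ((hupd i).comp (f := fun q : (Fin n → ℝ) × ℝ => (q.1, q.1 i - q.2))
        (by fun_prop))))
  have hPL : ∀ i x, ∫⁻ t, P i (Function.update x i t) ≤ L i x ^ 2 := by
    intro i x
    simp only [hP, hL, Function.update_self, Function.update_idem]
    exact lintegral_lintegral_add_mul_sub_le (g := fun t => G (Function.update x i t))
      (hG.comp (measurable_update x))
  have hLu : ∀ i x t, L i (Function.update x i t) = L i x := by
    intro i x t; simp [hL]
  have hP0 : ∀ i x, L i x = 0 → P i x = 0 := by
    intro i x h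
    simp only [hL] at h
    rw [lintegral_eq_zero_iff (f := fun t => G (Function.update x i t))
      (hG.comp (measurable_update x))] at h
    have h' := (measurePreserving_add_left volume (x i)).quasiMeasurePreserving.ae h
    simp only [hP]
    rw [lintegral_eq_zero_iff' ]
    · filter_upwards [h'] with r hr
      simp only [Pi.zero_apply] at hr
      simp [hr]
    · exact (Measurable.mul (hG.comp ((measurable_update x).comp (by fun_prop)))
        (hG.comp ((measurable_update x).comp (by fun_prop)))).aemeasurable
  -- `L i` is constant along lines in direction `i`, so on each such line the quotient integrates to
  -- at most `L i ^ 2 / L i`.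
  have hQ : ∀ i, ∫⁻ x, P i x / L i x ≤ ∫⁻ x, G x := by
    intro i
    refine lintegral_le_of_lmarginal_le {i} ((hPm i).div (hLm i)) hG ?_
    rw [lmarginal_singleton, lmarginal_singleton]
    intro x
    dsimp only
    simp_rw [hLu]
    simp_rw [div_eq_mul_inv]
    rw [lintegral_mul_const (f := fun t => P i (Function.update x i t)) _
      ((hPm i).comp (measurable_update x)), ← div_eq_mul_inv]
    refine ENNReal.div_le_of_le_mul ?_
    rw [← sq]
    exact hPL i x
  have hn1 : (1 : ℝ) ≤ n := by exact_mod_cast hn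
  set p : ℝ := 1 / (2 * n - 1) with hp
  have hp0 : 0 ≤ p := by rw [hp]; apply div_nonneg <;> linarith
  -- The exponent `n / (n - 1)` degenerates for `n = 1`; there `hPL` is already the claim.
  rcases eq_or_lt_of_le hn1 with h1 | h1
  · obtain rfl : n = 1 := by exact_mod_cast h1.symm
    have : p = 1 := by rw [hp]; norm_num
    simp only [this, Finset.univ_unique, Finset.prod_singleton, ENNReal.rpow_one]
    have e : ∀ x : Fin 1 → ℝ, L default x = ∫⁻ x, G x := by
      intro x
      rw [volume_pi, lintegral_eq_lmarginal_univ x, Finset.univ_unique, lmarginal_singleton]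
    have := hPL default (fun _ => 0)
    rw [e] at this
    refine le_trans (le_of_eq ?_) (this.trans_eq ?_)
    · rw [volume_pi, lintegral_eq_lmarginal_univ (fun _ => 0), Finset.univ_unique, lmarginal_singleton]
    · norm_num
  have hcard : (Fintype.card (Fin n) : ℝ) = n := by simp
  have hconj : Real.HolderConjugate (Fintype.card (Fin n) : ℝ) ((n : ℝ) / (n - 1)) := by
    rw [hcard]
    exact Real.HolderConjugate.conjExponent h1
  have hLW := lintegral_prod_lintegral_pow_le (μ := fun _ : Fin n => (volume : Measure ℝ)) hconj hG
  rw [hcard] at hLW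
  set F : (Fin n → ℝ) → ℝ≥0∞ := fun x => ∏ i, L i x ^ ((1 : ℝ) / (n - 1)) with hF
  have hFm : Measurable F := Finset.measurable_prod _ fun i _ => (hLm i).pow_const _
  have hLW' : ∫⁻ x, F x ≤ (∫⁻ x, G x) ^ ((n : ℝ) / (n - 1)) := hLW
  have hn0 : (n : ℝ) - 1 ≠ 0 := by linarith
  have h2n0 : 2 * (n : ℝ) - 1 ≠ 0 := by linarith
  -- Split `P i = L i * (P i / L i)`. Hölder has weight `(n-1)p` on the Loomis–Whitney product and
  -- weight `p` on each of the `n` quotients: `(n-1)p + np = 1`.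
  calc ∫⁻ x, ∏ i, P i x ^ p
      ≤ ∫⁻ x, F x ^ ((n - 1) * p) * ∏ i, (P i x / L i x) ^ p := by
        refine lintegral_mono fun x => ?_
        have : F x ^ ((n - 1) * p) = ∏ i, L i x ^ p := by
          rw [hF]
          simp only
          rw [← ENNReal.prod_rpow_of_nonneg (by apply mul_nonneg <;> linarith)]
          refine Finset.prod_congr rfl fun i _ => ?_
          rw [← ENNReal.rpow_mul]
          congr 1
          field_simp
        rw [this, mul_comm, ← Finset.prod_mul_distrib]
        exact Finset.prod_le_prod' fun i _ => rpow_le_div_rpow_mul hp0 (hfin x i) (hP0 i x)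
    _ ≤ (∫⁻ x, F x) ^ ((n - 1) * p) * ∏ i, (∫⁻ x, P i x / L i x) ^ p := by
        refine ENNReal.lintegral_mul_prod_norm_pow_le _ hFm.aemeasurable
          (fun i _ => ((hPm i).div (hLm i)).aemeasurable) _ ?_ ?_ fun _ _ => hp0
        · simp only [Finset.sum_const, Finset.card_univ, Fintype.card_fin, nsmul_eq_mul]
          rw [← add_mul, hp, show (n : ℝ) - 1 + n = 2 * n - 1 by ring, mul_one_div_cancel h2n0]
        · apply mul_nonneg <;> linarith
    _ ≤ ((∫⁻ x, G x) ^ ((n : ℝ) / (n - 1))) ^ ((n - 1) * p) * ∏ i : Fin n, (∫⁻ x, G x) ^ p := by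
        refine mul_le_mul' (ENNReal.rpow_le_rpow hLW' (mul_nonneg (by linarith) hp0))
          (Finset.prod_le_prod' fun i _ => ENNReal.rpow_le_rpow (hQ i) hp0)
    _ = (∫⁻ x, G x) ^ ((2 * n : ℝ) / (2 * n - 1)) := by
        rw [← ENNReal.rpow_mul, Finset.prod_const, Finset.card_univ, Fintype.card_fin,
          ← ENNReal.rpow_natCast, ← ENNReal.rpow_mul, ← ENNReal.rpow_add_of_nonneg]
        · congr 1
          rw [hp]; field_simp; ring
        · have : (n : ℝ) / (n - 1) * ((n - 1) * p) = n * p := by field_simp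
          rw [this]; positivity
        · positivity

/-- There are `n` linearly independent diagonal directions of the cube in `ℝⁿ`. -/
theorem exists_independent_diagonals {n : ℕ} (hn : 0 < n) :
    ∃ (σ : Fin n → Fin n → SignType) (T : (Fin n → ℝ) →ₗ[ℝ] (Fin n → ℝ)),
      (∀ i j, σ i j ≠ 0) ∧ LinearMap.det T ≠ 0 ∧
      ∀ x i r, T (Function.update x i (x i + r)) = fun j => T x j + r * (σ i j : ℝ) := by
  let o : Fin n := ⟨0, hn⟩
  -- The columns are the all-ones vector (at `o`) and, for `i ≠ o`, that vector with entry `i`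
  -- negated. Row `o` makes the coordinate sum of a kernel vector vanish, and the other rows then
  -- kill its entries.
  let T : (Fin n → ℝ) →ₗ[ℝ] (Fin n → ℝ) :=
    { toFun := fun x j => ∑ i, x i - if j = o then 0 else 2 * x j
      map_add' := by
        intro x y; funext j
        simp only [Pi.add_apply, Finset.sum_add_distrib]
        split_ifs <;> ring
      map_smul' := by
        intro c x; funext j
        simp only [Pi.smul_apply, smul_eq_mul, ← Finset.mul_sum, RingHom.id_apply]
        split_ifs <;> ring }
  have hT : ∀ x j, T x j = ∑ i, x i - if j = o then 0 else 2 * x j := fun _ _ => rfl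
  refine ⟨fun i j => if j ≠ o ∧ j = i then -1 else 1, T, ?_, ?_, ?_⟩
  · intro i j; dsimp only; split_ifs <;> decide
  · have hker : LinearMap.ker T = ⊥ := by
      rw [LinearMap.ker_eq_bot']
      intro x hx
      have h0 : ∑ i, x i = 0 := by simpa [hT] using congrFun hx o
      have h1 : ∀ j, j ≠ o → x j = 0 := by
        intro j hj
        simpa [hT, hj, h0] using congrFun hx j
      have h2 : x o = 0 := by
        have := Fintype.sum_eq_single (f := x) o fun j hj => h1 j hj
        rw [← this, h0]
      funext j
      by_cases hj : j = o
      · rw [hj, h2]; rfl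
      · exact h1 j hj
    have := LinearMap.isUnit_iff_ker_eq_bot T |>.2 hker
    exact (LinearMap.isUnit_det T this).ne_zero
  · intro x i r
    funext j
    have hs : ∑ l, Function.update x i (x i + r) l = ∑ l, x l + r := by
      rw [Finset.sum_update_of_mem (Finset.mem_univ i),
        ← Finset.add_sum_erase Finset.univ x (Finset.mem_univ i), Finset.sdiff_singleton_eq_erase]
      ring
    rw [hT, hT, hs]
    by_cases hj : j = o
    · simp [hj]
    · by_cases hji : j = i
      · subst hji; simp [hj]; ring
      · simp [hj, hji]; ring

/-- The estimate for symmetric pairs of points on lines in diagonal directions. -/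
theorem exists_lintegral_prod_diagonal_pairs_le {n : ℕ} (hn : 0 < n) :
    ∃ (σ : Fin n → Fin n → SignType) (C : ℝ≥0∞), (∀ i j, σ i j ≠ 0) ∧ C ≠ ∞ ∧
      ∀ G : (Fin n → ℝ) → ℝ≥0∞, Measurable G →
        (∀ (x : Fin n → ℝ) i, ∫⁻ r : ℝ, G (fun j => x j + r * (σ i j : ℝ)) ≠ ∞) →
        ∫⁻ x : Fin n → ℝ, ∏ i, (∫⁻ r : ℝ, G (fun j => x j + r * (σ i j : ℝ)) *
          G (fun j => x j - r * (σ i j : ℝ))) ^ ((1 : ℝ) / (2 * n - 1)) ≤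
        C * (∫⁻ x, G x) ^ ((2 * n : ℝ) / (2 * n - 1)) := by
  obtain ⟨σ, T, hσ, hdet, hT⟩ := exists_independent_diagonals hn
  set c : ℝ≥0∞ := ENNReal.ofReal |(LinearMap.det T)⁻¹| with hc
  have hc0 : c ≠ 0 := by
    rw [hc, ne_eq, ENNReal.ofReal_eq_zero, not_le, abs_pos]
    exact inv_ne_zero hdet
  have hctop : c ≠ ∞ := ENNReal.ofReal_ne_top
  have hn1 : (1 : ℝ) ≤ n := by exact_mod_cast hn
  have hq : (0 : ℝ) ≤ (2 * n : ℝ) / (2 * n - 1) := by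
    apply div_nonneg <;> linarith
  have hTm : Measurable T := (LinearMap.continuous_of_finiteDimensional T).measurable
  have hcv : ∀ F : (Fin n → ℝ) → ℝ≥0∞, Measurable F → ∫⁻ x, F (T x) = c * ∫⁻ x, F x := by
    intro F hF
    rw [← lintegral_map hF hTm, Real.map_linearMap_volume_pi_eq_smul_volume_pi hdet,
      lintegral_smul_measure, smul_eq_mul]
  refine ⟨σ, c⁻¹ * c ^ ((2 * n : ℝ) / (2 * n - 1)), hσ,
    ENNReal.mul_ne_top (ENNReal.inv_ne_top.2 hc0) (ENNReal.rpow_ne_top_of_nonneg hq hctop), ?_⟩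
  intro G hG hfin
  have hT' : ∀ x i r, T (Function.update x i (x i - r)) = fun j => T x j - r * (σ i j : ℝ) := by
    intro x i r
    have := hT x i (-r)
    rw [← sub_eq_add_neg] at this
    rw [this]; funext j; ring
  have key := lintegral_prod_line_pairs_le hn (hG.comp hTm) (by
    intro x i
    rw [← lintegral_add_left_eq_self _ (x i)]
    simp only [Function.comp_apply, hT]
    exact hfin _ _)
  simp only [Function.comp_apply, hT, hT'] at key
  have hPm : Measurable fun x : Fin n → ℝ => ∏ i, (∫⁻ r : ℝ, G (fun j => x j + r * (σ i j : ℝ)) *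
          G (fun j => x j - r * (σ i j : ℝ))) ^ ((1 : ℝ) / (2 * n - 1)) := by
    refine Finset.measurable_prod _ fun i _ => Measurable.pow_const ?_ _
    exact Measurable.lintegral_prod_right' (f := fun q : (Fin n → ℝ) × ℝ =>
      G (fun j => q.1 j + q.2 * (σ i j : ℝ)) * G (fun j => q.1 j - q.2 * (σ i j : ℝ)))
      ((hG.comp (by fun_prop)).mul (hG.comp (by fun_prop)))
  rw [hcv _ hPm, hcv _ hG, ENNReal.mul_rpow_of_nonneg _ _ hq] at key
  rw [mul_assoc]
  exact (ENNReal.mul_le_iff_le_inv hc0 hctop).1 key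

/-! ### Face neighbourhoods as boxes -/

theorem faceNbhd_eq_pi {n k : ℕ} {δ r : ℝ} (hδ : 0 < δ) (hr : 0 ≤ r) (j : FaceIndex n k)
    (x : Fin n → ℝ) :
    faceNbhd δ j x r = Set.univ.pi fun i =>
      if j.1 i = 0 then Ioo (x i - (r + δ)) (x i + (r + δ))
      else Ioo (x i + (j.1 i : ℝ) * r - δ) (x i + (j.1 i : ℝ) * r + δ) := by
  ext y
  simp only [faceNbhd, Metric.mem_thickening_iff, Set.mem_univ_pi, dist_pi_lt_iff hδ,
    Real.dist_eq, abs_sub_lt_iff]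
  constructor
  · rintro ⟨z, hz, hyz⟩ i
    have h1 := (Set.mem_univ_pi.1 hz) i
    have h2 := hyz i
    split_ifs at h1 ⊢ with h
    · rw [mem_Icc] at h1
      constructor <;> linarith
    · rw [mem_singleton_iff] at h1
      rw [h1] at h2
      constructor <;> linarith
  · intro hy
    -- A nearest point of the face: clamp `y i` in the full directions.
    refine ⟨fun i => if j.1 i = 0 then max (x i - r) (min (y i) (x i + r))
      else x i + (j.1 i : ℝ) * r, ?_, ?_⟩
    · refine Set.mem_univ_pi.2 fun i => ?_
      by_cases h : j.1 i = 0
      · simp only [h, if_true]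
        refine ⟨le_max_left _ _, max_le (by linarith) (min_le_right _ _)⟩
      · simp [h]
    · intro i
      have := hy i
      by_cases h : j.1 i = 0
      · simp only [h, if_true, mem_Ioo] at this ⊢
        rcases max_cases (x i - r) (min (y i) (x i + r)) with h1 | h1 <;>
        rcases min_cases (y i) (x i + r) with h2 | h2 <;> constructor <;> linarith
      · simp only [h, if_false, mem_Ioo] at this ⊢
        constructor <;> linarith

theorem isOpen_faceNbhd {n k : ℕ} (δ r : ℝ) (j : FaceIndex n k) (x : Fin n → ℝ) :
    IsOpen (faceNbhd δ j x r) := Metric.isOpen_thickening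

theorem volume_faceNbhd {n k : ℕ} {δ r : ℝ} (hδ : 0 < δ) (hr : 0 ≤ r) (j : FaceIndex n k)
    (x : Fin n → ℝ) : volume (faceNbhd δ j x r) =
      ∏ i, if j.1 i = 0 then ENNReal.ofReal (2 * (r + δ)) else ENNReal.ofReal (2 * δ) := by
  rw [faceNbhd_eq_pi hδ hr, volume_pi_pi]
  refine Finset.prod_congr rfl fun i _ => ?_
  split_ifs <;> rw [Real.volume_Ioo] <;> ring_nf

theorem volume_faceNbhd_ne_top {n k : ℕ} {δ r : ℝ} (hδ : 0 < δ) (hr : 0 ≤ r) (j : FaceIndex n k)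
    (x : Fin n → ℝ) : volume (faceNbhd δ j x r) ≠ ∞ := by
  rw [volume_faceNbhd hδ hr]
  refine ENNReal.prod_ne_top fun i _ => ?_
  split_ifs <;> exact ENNReal.ofReal_ne_top

theorem FaceIndex.card_ne_zero {n k : ℕ} (j : FaceIndex n k) :
    (Finset.univ.filter fun i => j.1 i ≠ 0).card = n - k := by
  have h := Finset.card_filter_add_card_filter_not (s := Finset.univ) (fun i => j.1 i = 0)
  rw [j.2, Finset.card_univ, Fintype.card_fin] at h
  have e : (Finset.univ.filter fun i => ¬ j.1 i = 0).card =
    (Finset.univ.filter fun i => j.1 i ≠ 0).card := rfl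
  omega

theorem pow_le_volume_faceNbhd {n k : ℕ} {δ r : ℝ} (hδ : 0 < δ) (hr : 1 ≤ r)
    (j : FaceIndex n k) (x : Fin n → ℝ) :
    ENNReal.ofReal δ ^ (n - k) ≤ volume (faceNbhd δ j x r) := by
  rw [volume_faceNbhd hδ (by linarith), ← j.card_ne_zero, ← Finset.prod_const,
    Finset.prod_filter]
  refine Finset.prod_le_prod' fun i _ => ?_
  by_cases h : j.1 i = 0
  · simp only [h, ne_eq, not_true_eq_false, if_false, if_true]
    rw [ENNReal.one_le_ofReal]; linarith
  · simp only [h, ne_eq, not_false_eq_true, if_false, if_true]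
    exact ENNReal.ofReal_le_ofReal (by linarith)

/-! ### Slab integrals at corners -/

/-- A sign vector on a set `J` of `n - k` coordinate directions gives a `k`-dimensional face. -/
def faceOfSigns {n k : ℕ} (J : Finset (Fin n)) (hJ : J.card = n - k) (hkn : k < n)
    (σ : Fin n → SignType) (hσ : ∀ i, σ i ≠ 0) : FaceIndex n k :=
  ⟨fun i => if i ∈ J then σ i else 0, by
    have : (Finset.univ.filter fun i => (if i ∈ J then σ i else 0) = 0) = Jᶜ := by
      ext i; by_cases h : i ∈ J <;> simp [h, hσ i]
    rw [this, Finset.card_compl, hJ, Fintype.card_fin]; omega⟩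

/-- The integral over the slab of points whose `J`-coordinates are `ρ`-close to those of `x`. -/
noncomputable def slabIntegral {n : ℕ} (J : Finset (Fin n)) (ρ : ℝ) (f : (Fin n → ℝ) → ℝ≥0∞)
    (x : Fin n → ℝ) : ℝ≥0∞ :=
  ∫⁻ y, if ∀ i ∈ J, |x i - y i| < ρ then f y else 0

theorem measurableSet_slab {n : ℕ} (J : Finset (Fin n)) (ρ : ℝ) :
    MeasurableSet {q : (Fin n → ℝ) × (Fin n → ℝ) | ∀ i ∈ J, |q.1 i - q.2 i| < ρ} := by
  have : {q : (Fin n → ℝ) × (Fin n → ℝ) | ∀ i ∈ J, |q.1 i - q.2 i| < ρ} =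
      ⋂ i ∈ J, {q | |q.1 i - q.2 i| < ρ} := by ext; simp
  rw [this]
  exact Finset.measurableSet_biInter _ fun i _ =>
    (isOpen_lt (by fun_prop) (by fun_prop)).measurableSet

theorem measurable_slabIntegral {n : ℕ} (J : Finset (Fin n)) (ρ : ℝ) {f : (Fin n → ℝ) → ℝ≥0∞}
    (hf : Measurable f) : Measurable (slabIntegral J ρ f) := by
  refine Measurable.lintegral_prod_right' (f := fun q : (Fin n → ℝ) × (Fin n → ℝ) =>
    if ∀ i ∈ J, |q.1 i - q.2 i| < ρ then f q.2 else 0) ?_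
  exact Measurable.ite (measurableSet_slab J ρ) (hf.comp measurable_snd) measurable_const

theorem slabIntegral_update {n : ℕ} {J : Finset (Fin n)} (ρ : ℝ) (f : (Fin n → ℝ) → ℝ≥0∞)
    {i : Fin n} (hi : i ∉ J) (x : Fin n → ℝ) (t : ℝ) :
    slabIntegral J ρ f (Function.update x i t) = slabIntegral J ρ f x := by
  unfold slabIntegral
  refine lintegral_congr fun y => if_congr (forall₂_congr fun l hl => ?_) rfl rfl
  rw [Function.update_of_ne]
  rintro rfl; exact hi hl

theorem slabIntegral_le {n : ℕ} (J : Finset (Fin n)) (ρ : ℝ) (f : (Fin n → ℝ) → ℝ≥0∞)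
    (x : Fin n → ℝ) : slabIntegral J ρ f x ≤ ∫⁻ y, f y :=
  lintegral_mono fun y => by split_ifs <;> simp

/-- Tonelli: for fixed `y` the admissible `J`-coordinates form a sup-norm ball of radius `ρ`. -/
theorem lmarginal_slabIntegral {n : ℕ} (J : Finset (Fin n)) {ρ : ℝ} (hρ : 0 < ρ)
    {f : (Fin n → ℝ) → ℝ≥0∞} (hf : Measurable f) (x : Fin n → ℝ) :
    (∫⋯∫⁻_J, slabIntegral J ρ f ∂(fun _ => volume)) x =
      ENNReal.ofReal (2 * ρ) ^ J.card * ∫⁻ y, f y := by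
  have e : ∀ z : J → ℝ, slabIntegral J ρ f (Function.updateFinset x J z) =
      ∫⁻ y, if ∀ i : J, |z i - y i| < ρ then f y else 0 := by
    intro z
    unfold slabIntegral
    refine lintegral_congr fun y => ?_
    have : (∀ i ∈ J, |Function.updateFinset x J z i - y i| < ρ) ↔ ∀ i : J, |z i - y i| < ρ := by
      constructor
      · rintro h ⟨i, hi⟩
        simpa [Function.updateFinset, hi] using h i hi
      · intro h i hi
        simpa [Function.updateFinset, hi] using h ⟨i, hi⟩
    simp only [this]
  have hms : MeasurableSet {q : (J → ℝ) × (Fin n → ℝ) | ∀ i : J, |q.1 i - q.2 i| < ρ} := by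
    rw [ofPred_forall]
    exact MeasurableSet.iInter fun i => (isOpen_lt (by fun_prop) (by fun_prop)).measurableSet
  rw [lmarginal]
  simp_rw [e]
  rw [lintegral_lintegral_swap]
  · have : ∀ y : Fin n → ℝ, (∫⁻ z : J → ℝ, (if ∀ i : J, |z i - y i| < ρ then f y else 0)
        ∂(Measure.pi fun _ => volume)) = ENNReal.ofReal (2 * ρ) ^ J.card * f y := by
      intro y
      have hs : {z : J → ℝ | ∀ i : J, |z i - y i| < ρ} = Metric.ball (fun i : J => y i) ρ := by
        ext z; simp [Metric.mem_ball, dist_pi_lt_iff hρ, Real.dist_eq]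
      have : (fun z : J → ℝ => if ∀ i : J, |z i - y i| < ρ then f y else 0) =
          (Metric.ball (fun i : J => y i) ρ).indicator fun _ => f y := by
        funext z
        rw [← hs, indicator_apply]; rfl
      rw [this, lintegral_indicator_const Metric.isOpen_ball.measurableSet, ← volume_pi,
        Real.volume_pi_ball _ hρ, mul_comm, Fintype.card_coe, ENNReal.ofReal_pow (by positivity)]
    simp_rw [this]
    rw [lintegral_const_mul _ hf]
  · exact (Measurable.ite hms (hf.comp measurable_snd) measurable_const).aemeasurable

/-- The skeleton maximal function of a function with values in `[0, ∞]`. -/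
noncomputable def nbhdMaximal (n k : ℕ) (δ : ℝ) (g : (Fin n → ℝ) → ℝ≥0∞) (x : Fin n → ℝ) :
    ℝ≥0∞ :=
  ⨆ r ∈ Icc (1 : ℝ) 2, ⨅ j : FaceIndex n k,
    (∫⁻ y in faceNbhd δ j x r, g y) / volume (faceNbhd δ j x r)

/-- The minimum is tested on the face with signs `σ` on `J`. Width `2 * δ` leaves room for moving
the radius by `δ`, and the ball of radius `4` contains the face neighbourhood because `1 + 2 + δ <
4`. -/
theorem iInf_faceAverage_le_slabIntegral {n k : ℕ} (hkn : k < n) {δ r r' : ℝ} (hδ : 0 < δ)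
    (hδ1 : δ < 1) (hr : r ∈ Icc (1 : ℝ) 2) (hr' : |r' - r| < δ) (g : (Fin n → ℝ) → ℝ≥0∞)
    {c x : Fin n → ℝ} (hx : ∀ i, |x i - c i| ≤ 1) (σ : Fin n → SignType) (hσ : ∀ i, σ i ≠ 0)
    {J : Finset (Fin n)} (hJ : J.card = n - k) :
    ⨅ j : FaceIndex n k, (∫⁻ y in faceNbhd δ j x r, g y) / volume (faceNbhd δ j x r) ≤
      (ENNReal.ofReal δ ^ (n - k))⁻¹ * slabIntegral J (2 * δ)
        ((Metric.ball c 4).indicator g) (fun i => x i + r' * (σ i : ℝ)) := by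
  obtain ⟨hr1, hr2⟩ := hr
  refine (iInf_le _ (faceOfSigns J hJ hkn σ hσ)).trans ?_
  rw [div_eq_mul_inv, mul_comm]
  have hj : ∀ i, (faceOfSigns J hJ hkn σ hσ).1 i = if i ∈ J then σ i else 0 := fun _ => rfl
  gcongr
  · exact pow_le_volume_faceNbhd hδ hr1 _ _
  · rw [← lintegral_indicator (isOpen_faceNbhd _ _ _ _).measurableSet, slabIntegral]
    refine lintegral_mono fun y => ?_
    by_cases hy : y ∈ faceNbhd δ (faceOfSigns J hJ hkn σ hσ) x r
    swap
    · simp [hy]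
    rw [indicator_of_mem hy]
    rw [faceNbhd_eq_pi hδ (by linarith), Set.mem_univ_pi] at hy
    have hsig : ∀ i, |(σ i : ℝ)| = 1 := by
      intro i
      have := hσ i
      rcases h : σ i with _ | _ | _ <;> simp_all
    have h1 : ∀ i ∈ J, |x i + r' * (σ i : ℝ) - y i| < 2 * δ := by
      intro i hi
      have h := hy i
      rw [hj, if_pos hi, if_neg (hσ i)] at h
      have h2 : |(x i + (σ i : ℝ) * r) - y i| < δ := by
        rw [abs_sub_lt_iff]; constructor <;> linarith [h.1, h.2]
      have h3 : |(r' - r) * (σ i : ℝ)| < δ := by rwa [abs_mul, hsig, mul_one]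
      have h4 : x i + r' * (σ i : ℝ) - y i =
        (x i + (σ i : ℝ) * r - y i) + (r' - r) * (σ i : ℝ) := by ring
      rw [h4]
      linarith [abs_add_le (x i + (σ i : ℝ) * r - y i) ((r' - r) * (σ i : ℝ))]
    have h2 : y ∈ Metric.ball c 4 := by
      rw [Metric.mem_ball, dist_pi_lt_iff (by norm_num)]
      intro i
      have h := hy i
      have hc := abs_le.1 (hx i)
      rw [Real.dist_eq, abs_sub_lt_iff]
      rw [hj] at h
      by_cases hi : i ∈ J
      · rw [if_pos hi, if_neg (hσ i)] at h
        have hs := abs_le.1 (show |(σ i : ℝ) * r| ≤ 2 by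
          rw [abs_mul, hsig, one_mul, abs_of_nonneg] <;> linarith)
        constructor <;> linarith [h.1, h.2, hs.1, hs.2]
      · rw [if_neg hi, if_pos rfl] at h
        constructor <;> linarith [h.1, h.2]
    rw [if_pos h1, indicator_of_mem h2]

/-! ### Geometric means of slab integrals over cyclic intervals -/

/-- `d` cyclically consecutive coordinate directions, starting at `a`. -/
def cyclicInterval {n : ℕ} (d : ℕ) (a : Fin n) : Finset (Fin n) :=
  Finset.univ.filter fun i => (i - a).val < d

theorem card_filter_val_lt {n d : ℕ} (hd : d ≤ n) :
    (Finset.univ.filter fun b : Fin n => b.val < d).card = d := by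
  rw [Fin.card_filter_val_lt]
  exact min_eq_right hd

theorem card_cyclicInterval {n d : ℕ} (hd : d ≤ n) (a : Fin n) :
    (cyclicInterval d a).card = d := by
  have : NeZero n := ⟨by rintro rfl; exact a.elim0⟩
  conv_rhs => rw [← card_filter_val_lt hd]
  exact Finset.card_equiv (Equiv.subRight a) (by simp [cyclicInterval])

theorem card_filter_mem_cyclicInterval {n d : ℕ} (hd : d ≤ n) (i : Fin n) :
    (Finset.univ.filter fun a : Fin n => i ∈ cyclicInterval d a).card = d := by
  have : NeZero n := ⟨by rintro rfl; exact i.elim0⟩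
  conv_rhs => rw [← card_filter_val_lt hd]
  exact Finset.card_equiv (Equiv.subLeft i) (by simp [cyclicInterval])

/-- Jensen's inequality for concave powers. -/
theorem lintegral_rpow_le_rpow_mul {α : Type*} [MeasurableSpace α] {μ : Measure α}
    {f : α → ℝ≥0∞} (hf : AEMeasurable f μ) {t : ℝ} (ht0 : 0 ≤ t) (ht1 : t ≤ 1) :
    ∫⁻ x, f x ^ t ∂μ ≤ (∫⁻ x, f x ∂μ) ^ t * μ univ ^ (1 - t) := by
  have := ENNReal.lintegral_mul_norm_pow_le hf (aemeasurable_const (b := (1 : ℝ≥0∞)))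
    ht0 (sub_nonneg.2 ht1) (by ring)
  simpa using this

/-- The geometric mean, over the cyclic intervals, of the slab integrals. -/
noncomputable def slabMean {n : ℕ} (d : ℕ) (ρ : ℝ) (f : (Fin n → ℝ) → ℝ≥0∞) (x : Fin n → ℝ) :
    ℝ≥0∞ :=
  ∏ a : Fin n, slabIntegral (cyclicInterval d a) ρ f x ^ ((1 : ℝ) / d)

theorem measurable_slabMean {n : ℕ} (d : ℕ) (ρ : ℝ) {f : (Fin n → ℝ) → ℝ≥0∞} (hf : Measurable f) :
    Measurable (slabMean d ρ f) :=
  Finset.measurable_prod _ fun _ _ => (measurable_slabIntegral _ _ hf).pow_const _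

/-- Each coordinate lies in exactly `d` of the `n` cyclic intervals, so the weights `1 / d` satisfy
Finner's condition. -/
theorem lintegral_slabMean_le {n d : ℕ} (hd0 : 0 < d) (hd : d ≤ n) {ρ : ℝ} (hρ : 0 < ρ)
    {f : (Fin n → ℝ) → ℝ≥0∞} (hf : Measurable f) :
    ∫⁻ x, slabMean d ρ f x ≤ (ENNReal.ofReal (2 * ρ) ^ d * ∫⁻ y, f y) ^ ((n : ℝ) / d) := by
  have hd' : (d : ℝ) ≠ 0 := by positivity
  refine (lintegral_prod_rpow_le (fun a => measurable_slabIntegral _ ρ hf) (cyclicInterval d)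
    (fun a i hi x t => slabIntegral_update ρ f hi x t) (θ := fun _ => (1 : ℝ) / d)
    (fun _ => by positivity) (fun i => ?_) (fun _ => 0)).trans_eq ?_
  · rw [Finset.sum_const, card_filter_mem_cyclicInterval hd, nsmul_eq_mul]
    field_simp
  · simp_rw [lmarginal_slabIntegral _ hρ hf, card_cyclicInterval hd]
    rw [Finset.prod_const, Finset.card_univ, Fintype.card_fin, ← ENNReal.rpow_natCast,
      ← ENNReal.rpow_mul]
    congr 1
    ring

/-- This is the finiteness needed to divide by line integrals. Along a diagonal the mean is bounded
by a power of the total mass and vanishes for large `|r|`, since coordinate `0` then leaves the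
slab. -/
theorem slabMean_lineIntegral_ne_top {n d : ℕ} (hd0 : 0 < d) (hn : 0 < n) {ρ : ℝ}
    {c : Fin n → ℝ} {R : ℝ} {f : (Fin n → ℝ) → ℝ≥0∞} (hf : ∫⁻ y, f y ≠ ∞)
    (hsupp : ∀ y ∉ Metric.ball c R, f y = 0) (x : Fin n → ℝ)
    {σ : Fin n → SignType} (hσ : ∀ i, σ i ≠ 0) :
    ∫⁻ r : ℝ, slabMean d ρ f (fun j => x j + r * (σ j : ℝ)) ≠ ∞ := by
  have : NeZero n := ⟨hn.ne'⟩
  set K : ℝ≥0∞ := ∏ _a : Fin n, (∫⁻ y, f y) ^ ((1 : ℝ) / d) with hK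
  have hKtop : K ≠ ∞ := ENNReal.prod_ne_top fun _ _ =>
    ENNReal.rpow_ne_top_of_nonneg (by positivity) hf
  have hle : ∀ z, slabMean d ρ f z ≤ K := fun z =>
    Finset.prod_le_prod' fun a _ => ENNReal.rpow_le_rpow (slabIntegral_le _ _ _ _) (by positivity)
  set B : ℝ := ρ + R + |x 0 - c 0| with hB
  have hzero : ∀ r : ℝ, r ∉ Icc (-B) B → slabMean d ρ f (fun j => x j + r * (σ j : ℝ)) = 0 := by
    intro r hr
    refine Finset.prod_eq_zero (Finset.mem_univ 0) ?_
    rw [ENNReal.rpow_eq_zero_iff]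
    refine Or.inl ⟨?_, by positivity⟩
    unfold slabIntegral
    refine (lintegral_congr fun y => ?_).trans lintegral_zero
    by_cases hy : y ∈ Metric.ball c R
    · rw [if_neg]
      intro h
      have h0 := h 0 (by simp [cyclicInterval, hd0])
      have h1 : |y 0 - c 0| < R := by
        rw [← Real.dist_eq]
        exact (dist_le_pi_dist y c 0).trans_lt hy
      have hs : |(σ 0 : ℝ)| = 1 := by
        have := hσ 0
        rcases h : σ 0 with _ | _ | _ <;> simp_all
      apply hr
      rw [mem_Icc, ← abs_le]
      have h2 : |r| = |r * (σ 0 : ℝ)| := by rw [abs_mul, hs, mul_one]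
      rw [h2, show r * (σ 0 : ℝ) = (x 0 + r * (σ 0 : ℝ) - y 0) + (y 0 - c 0) + -(x 0 - c 0) by ring]
      refine (abs_add_three _ _ _).trans ?_
      rw [abs_neg, hB]
      linarith
    · simp [hsupp y hy]
  have : ∫⁻ r : ℝ, slabMean d ρ f (fun j => x j + r * (σ j : ℝ)) ≤
      ∫⁻ r : ℝ, (Icc (-B) B).indicator (fun _ => K) r := by
    refine lintegral_mono fun r => ?_
    by_cases hr : r ∈ Icc (-B) B
    · rw [indicator_of_mem hr]; exact hle _
    · rw [hzero r hr]; exact zero_le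
  refine ne_top_of_le_ne_top ?_ this
  rw [lintegral_indicator_const measurableSet_Icc, Real.volume_Icc]
  exact ENNReal.mul_ne_top hKtop ENNReal.ofReal_ne_top

/-- A power of the maximal function is controlled by symmetric pairs on any diagonal line. -/
theorem nbhdMaximal_rpow_le {n k : ℕ} (hkn : k < n) {δ : ℝ} (hδ : 0 < δ) (hδ1 : δ < 1)
    {g : (Fin n → ℝ) → ℝ≥0∞} {c x : Fin n → ℝ} (hx : ∀ i, |x i - c i| ≤ 1)
    {σ : Fin n → SignType} (hσ : ∀ i, σ i ≠ 0) :
    nbhdMaximal n k δ g x ^ ((2 * n : ℝ) / ((n - k : ℕ) : ℝ)) ≤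
      (ENNReal.ofReal δ ^ (2 * n + 1))⁻¹ * ∫⁻ r : ℝ,
        slabMean (n - k) (2 * δ) ((Metric.ball c 4).indicator g) (fun j => x j + r * (σ j : ℝ)) *
        slabMean (n - k) (2 * δ) ((Metric.ball c 4).indicator g)
          (fun j => x j - r * (σ j : ℝ)) := by
  set d := n - k with hd
  have hd0 : 0 < d := by omega
  have hdn : d ≤ n := by omega
  set D := ENNReal.ofReal δ with hD
  have hD0 : D ≠ 0 := by simp [hD, hδ]
  have hDtop : D ≠ ∞ := ENNReal.ofReal_ne_top
  have hdR : (0 : ℝ) < d := by exact_mod_cast hd0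
  have hnR : (0 : ℝ) < n := by exact_mod_cast hd0.trans_le hdn
  set G := slabMean d (2 * δ) ((Metric.ball c 4).indicator g) with hG
  have hpow : (0 : ℝ) < (2 * n : ℝ) / d := by positivity
  rw [← ENNReal.le_rpow_inv_iff hpow]
  refine iSup₂_le fun r hr => ?_
  rw [ENNReal.le_rpow_inv_iff hpow]
  set m := ⨅ j : FaceIndex n k,
    (∫⁻ y in faceNbhd δ j x r, g y) / volume (faceNbhd δ j x r) with hm
  have key : ∀ (τ : Fin n → SignType), (∀ i, τ i ≠ 0) → ∀ r', |r' - r| < δ →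
      m ^ ((n : ℝ) / d) ≤ (D ^ n)⁻¹ * G (fun j => x j + r' * (τ j : ℝ)) := by
    intro τ hτ r' hr'
    calc m ^ ((n : ℝ) / d) = ∏ _a : Fin n, m ^ ((1 : ℝ) / d) := by
          rw [Finset.prod_const, Finset.card_univ, Fintype.card_fin, ← ENNReal.rpow_natCast,
            ← ENNReal.rpow_mul]
          congr 1
          ring
      _ ≤ ∏ a : Fin n, ((D ^ d)⁻¹ * slabIntegral (cyclicInterval d a) (2 * δ)
            ((Metric.ball c 4).indicator g) (fun i => x i + r' * (τ i : ℝ))) ^ ((1 : ℝ) / d) :=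
          Finset.prod_le_prod' fun a _ => ENNReal.rpow_le_rpow
            (iInf_faceAverage_le_slabIntegral hkn hδ hδ1 hr hr' g hx τ hτ
              (card_cyclicInterval hdn a)) (by positivity)
      _ = _ := by
          simp_rw [ENNReal.mul_rpow_of_nonneg _ _ (show (0 : ℝ) ≤ 1 / d by positivity)]
          rw [Finset.prod_mul_distrib, Finset.prod_const, Finset.card_univ, Fintype.card_fin]
          congr 1
          rw [ENNReal.inv_rpow, ← ENNReal.rpow_natCast D d, ← ENNReal.rpow_mul,
            mul_one_div_cancel hdR.ne', ENNReal.rpow_one, ENNReal.inv_pow]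
  have hpair : ∀ r', |r' - r| < δ → m ^ ((2 * n : ℝ) / d) ≤ (D ^ (2 * n))⁻¹ *
      (G (fun j => x j + r' * (σ j : ℝ)) * G (fun j => x j - r' * (σ j : ℝ))) := by
    intro r' hr'
    have h1 := key σ hσ r' hr'
    -- The opposite corner supplies the second factor of the pair.
    have h2 := key (fun i => - σ i) (fun i => by simpa using hσ i) r' hr'
    have e : (fun j => x j + r' * ((- σ j : SignType) : ℝ)) = fun j => x j - r' * (σ j : ℝ) := by
      funext j; rw [SignType.coe_neg]; ring
    rw [e] at h2
    calc m ^ ((2 * n : ℝ) / d) = m ^ ((n : ℝ) / d) * m ^ ((n : ℝ) / d) := by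
          rw [← ENNReal.rpow_add_of_nonneg _ _ (by positivity) (by positivity)]
          congr 1; ring
      _ ≤ _ := mul_le_mul' h1 h2
      _ = _ := by
          rw [two_mul, pow_add, ENNReal.mul_inv (Or.inl (pow_ne_zero _ hD0))
            (Or.inl (ENNReal.pow_ne_top hDtop))]
          ring
  -- The pair bound holds for all `r'` within `δ` of `r`; integrating over them costs one factor `δ`
  -- and removes the dependence on `r`.
  have hint : D * m ^ ((2 * n : ℝ) / d) ≤ (D ^ (2 * n))⁻¹ * ∫⁻ r' : ℝ,
      G (fun j => x j + r' * (σ j : ℝ)) * G (fun j => x j - r' * (σ j : ℝ)) := by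
    calc D * m ^ ((2 * n : ℝ) / d) ≤ volume (Metric.ball r δ) * m ^ ((2 * n : ℝ) / d) := by
          gcongr
          rw [Real.volume_ball]
          exact ENNReal.ofReal_le_ofReal (by linarith)
      _ = ∫⁻ r' in Metric.ball r δ, m ^ ((2 * n : ℝ) / d) := by
          rw [setLIntegral_const, mul_comm]
      _ ≤ ∫⁻ r' in Metric.ball r δ, (D ^ (2 * n))⁻¹ *
            (G (fun j => x j + r' * (σ j : ℝ)) * G (fun j => x j - r' * (σ j : ℝ))) :=
          setLIntegral_mono' Metric.isOpen_ball.measurableSet fun r' hr' =>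
            hpair r' (by rwa [Metric.mem_ball, Real.dist_eq] at hr')
      _ ≤ ∫⁻ r' : ℝ, (D ^ (2 * n))⁻¹ *
            (G (fun j => x j + r' * (σ j : ℝ)) * G (fun j => x j - r' * (σ j : ℝ))) :=
          setLIntegral_le_lintegral _ _
      _ = _ := lintegral_const_mul' _ _ (ENNReal.inv_ne_top.2 (pow_ne_zero _ hD0))
  rw [ENNReal.mul_le_iff_le_inv hD0 hDtop, ← mul_assoc] at hint
  refine hint.trans_eq ?_
  rw [pow_succ', ENNReal.mul_inv (Or.inl hD0) (Or.inl hDtop)]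

/-! ### The `L¹` bound, local and global -/

/-- The half-open unit cube with lower corner `c`. -/
def unitCube {n : ℕ} (c : Fin n → ℝ) : Set (Fin n → ℝ) :=
  Set.univ.pi fun i => Ico (c i) (c i + 1)

theorem measurableSet_unitCube {n : ℕ} (c : Fin n → ℝ) : MeasurableSet (unitCube c) :=
  MeasurableSet.univ_pi fun _ => measurableSet_Ico

theorem volume_unitCube {n : ℕ} (c : Fin n → ℝ) : volume (unitCube c) = 1 := by
  rw [unitCube, volume_pi_pi]
  simp

/-- The local `L¹` estimate. -/
theorem exists_setLIntegral_nbhdMaximal_le {n k : ℕ} (hkn : k < n) :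
    ∃ C : ℝ≥0∞, C ≠ ∞ ∧ ∀ δ : ℝ, 0 < δ → δ < 1 → ∀ g : (Fin n → ℝ) → ℝ≥0∞,
      Measurable g → ∀ c : Fin n → ℝ, ∫⁻ x in unitCube c, nbhdMaximal n k δ g x ≤
        C * ENNReal.ofReal (δ ^ (((k : ℝ) - n) / (2 * n))) * ∫⁻ y in Metric.ball c 4, g y := by
  have hn : 0 < n := by omega
  obtain ⟨σ, A, hσ, hA, hGA⟩ := exists_lintegral_prod_diagonal_pairs_le hn
  set d := n - k with hd
  have hd0 : 0 < d := by omega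
  have hdn : d ≤ n := by omega
  have hdR : (0 : ℝ) < d := by exact_mod_cast hd0
  have hdnR : (d : ℝ) ≤ n := by exact_mod_cast hdn
  have hdcast : (d : ℝ) = n - k := by rw [hd, Nat.cast_sub hkn.le]
  have hnR : (1 : ℝ) ≤ n := by exact_mod_cast hn
  have h2n : (0 : ℝ) < 2 * n - 1 := by linarith
  -- Chosen so that `(2n/d) * (n/(2n-1)) * t = 1`: this turns the product bound into a bound for the
  -- maximal function itself, and later makes the result linear in `∫ f`.
  set t : ℝ := d * (2 * n - 1) / (2 * n ^ 2) with ht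
  have ht0 : 0 < t := by positivity
  have ht1 : t ≤ 1 := by
    rw [ht, div_le_one (by positivity)]
    nlinarith
  -- `A + 1` keeps the constant nonzero, so the bound is `∞` when `∫ f = ∞`.
  refine ⟨ENNReal.ofReal 4 ^ d * (A + 1) ^ t, ?_, ?_⟩
  · refine ENNReal.mul_ne_top (ENNReal.pow_ne_top ENNReal.ofReal_ne_top)
      (ENNReal.rpow_ne_top_of_nonneg ht0.le (by simp [hA]))
  intro δ hδ hδ1 g hg c
  set f := (Metric.ball c 4).indicator g with hf
  have hfm : Measurable f := hg.indicator Metric.isOpen_ball.measurableSet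
  have hfI : ∫⁻ y in Metric.ball c 4, g y = ∫⁻ y, f y :=
    (lintegral_indicator Metric.isOpen_ball.measurableSet _).symm
  rw [hfI]
  set e : ℝ := ((k : ℝ) - n) / (2 * n) with he
  rcases eq_or_ne (∫⁻ y, f y) ∞ with hI | hI
  · rw [hI, ENNReal.mul_top]
    · exact le_top
    · refine mul_ne_zero (mul_ne_zero (pow_ne_zero _ (by simp)) ?_) ?_
      · simp [ENNReal.rpow_eq_zero_iff, hA]
      · simp [Real.rpow_pos_of_pos hδ]
  set D := ENNReal.ofReal δ with hD
  set K : ℝ≥0∞ := (D ^ (2 * n + 1))⁻¹ with hK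
  set G := slabMean d (2 * δ) f with hG
  have hGm : Measurable G := measurable_slabMean _ _ hfm
  set P : Fin n → (Fin n → ℝ) → ℝ≥0∞ := fun i x => ∫⁻ r : ℝ,
    G (fun j => x j + r * (σ i j : ℝ)) * G (fun j => x j - r * (σ i j : ℝ)) with hP
  have hPm : ∀ i, Measurable (P i) := fun i =>
    Measurable.lintegral_prod_right' (f := fun q : (Fin n → ℝ) × ℝ =>
      G (fun j => q.1 j + q.2 * (σ i j : ℝ)) * G (fun j => q.1 j - q.2 * (σ i j : ℝ)))
      ((hGm.comp (by fun_prop)).mul (hGm.comp (by fun_prop)))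
  set N : (Fin n → ℝ) → ℝ≥0∞ := fun x => ∏ i, P i x ^ ((1 : ℝ) / (2 * n - 1)) with hN
  have hNm : Measurable N := Finset.measurable_prod _ fun i _ => (hPm i).pow_const _
  have hNint : ∫⁻ x, N x ≤ A * (∫⁻ x, G x) ^ ((2 * n : ℝ) / (2 * n - 1)) :=
    hGA G hGm fun x i => slabMean_lineIntegral_ne_top (c := c) (R := 4) hd0 hn hI
      (fun y hy => indicator_of_notMem hy _) x (hσ i)
  have hGint : ∫⁻ x, G x ≤ (ENNReal.ofReal (2 * (2 * δ)) ^ d * ∫⁻ y, f y) ^ ((n : ℝ) / d) :=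
    lintegral_slabMean_le hd0 hdn (by positivity) hfm
  have hpt : ∀ x ∈ unitCube c, nbhdMaximal n k δ g x ≤ K ^ ((d : ℝ) / (2 * n)) * N x ^ t := by
    intro x hx
    have hxc : ∀ i, |x i - c i| ≤ 1 := by
      intro i
      have := hx i (mem_univ i)
      rw [abs_le]; constructor <;> linarith [this.1, this.2]
    calc nbhdMaximal n k δ g x
        = (∏ _i : Fin n, (nbhdMaximal n k δ g x ^ ((2 * n : ℝ) / d)) ^
            ((1 : ℝ) / (2 * n - 1))) ^ t := by
          rw [Finset.prod_const, Finset.card_univ, Fintype.card_fin, ← ENNReal.rpow_natCast,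
            ← ENNReal.rpow_mul, ← ENNReal.rpow_mul, ← ENNReal.rpow_mul]
          conv_lhs => rw [← ENNReal.rpow_one (nbhdMaximal n k δ g x)]
          congr 1
          rw [ht]; field_simp
      _ ≤ (∏ i : Fin n, (K * P i x) ^ ((1 : ℝ) / (2 * n - 1))) ^ t := by
          refine ENNReal.rpow_le_rpow (Finset.prod_le_prod' fun i _ =>
            ENNReal.rpow_le_rpow ?_ (by positivity)) ht0.le
          exact nbhdMaximal_rpow_le hkn hδ hδ1 hxc (hσ i)
      _ = K ^ ((d : ℝ) / (2 * n)) * N x ^ t := by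
          simp_rw [ENNReal.mul_rpow_of_nonneg _ _ (show (0 : ℝ) ≤ 1 / (2 * n - 1) by positivity)]
          rw [Finset.prod_mul_distrib, Finset.prod_const, Finset.card_univ, Fintype.card_fin,
            ENNReal.mul_rpow_of_nonneg _ _ ht0.le, ← ENNReal.rpow_natCast (K ^ _),
            ← ENNReal.rpow_mul, ← ENNReal.rpow_mul]
          congr 2
          rw [ht]; field_simp
  have hKtop : K ^ ((d : ℝ) / (2 * n)) ≠ ∞ :=
    ENNReal.rpow_ne_top_of_nonneg (by positivity)
      (ENNReal.inv_ne_top.2 (pow_ne_zero _ (by simp [hD, hδ])))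
  -- The power count: `δ^(-(2n+1)d/(2n)) * δ^d = δ^(-d/(2n))`.
  have hKD : K ^ ((d : ℝ) / (2 * n)) * ENNReal.ofReal (2 * (2 * δ)) ^ d =
      ENNReal.ofReal 4 ^ d * ENNReal.ofReal (δ ^ e) := by
    have h1 : K = ENNReal.ofReal (δ ^ (-(2 * n + 1 : ℝ))) := by
      rw [hK, hD, ← ENNReal.ofReal_pow hδ.le, ← ENNReal.ofReal_inv_of_pos (by positivity),
        Real.rpow_neg hδ.le, ← Real.rpow_natCast]
      push_cast; rfl
    rw [h1, ENNReal.ofReal_rpow_of_pos (by positivity), ← Real.rpow_mul hδ.le,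
      ← ENNReal.ofReal_pow (by positivity), ← ENNReal.ofReal_pow (by positivity),
      ← ENNReal.ofReal_mul (by positivity), ← ENNReal.ofReal_mul (by positivity)]
    congr 1
    rw [show 2 * (2 * δ) = 4 * δ by ring, mul_pow, mul_left_comm, ← Real.rpow_natCast δ d,
      ← Real.rpow_add hδ]
    congr 2
    rw [he, show (k : ℝ) = n - d by linarith]
    field_simp
    ring
  calc ∫⁻ x in unitCube c, nbhdMaximal n k δ g x
      ≤ ∫⁻ x in unitCube c, K ^ ((d : ℝ) / (2 * n)) * N x ^ t :=
        setLIntegral_mono' (measurableSet_unitCube c) hpt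
    _ = K ^ ((d : ℝ) / (2 * n)) * ∫⁻ x in unitCube c, N x ^ t :=
        lintegral_const_mul' _ _ hKtop
    _ ≤ K ^ ((d : ℝ) / (2 * n)) * ((A + 1) ^ t *
          (ENNReal.ofReal (2 * (2 * δ)) ^ d * ∫⁻ y, f y)) := by
        gcongr
        calc ∫⁻ x in unitCube c, N x ^ t
            ≤ (∫⁻ x in unitCube c, N x) ^ t := by
              refine (lintegral_rpow_le_rpow_mul hNm.aemeasurable ht0.le ht1).trans_eq ?_
              rw [Measure.restrict_apply_univ, volume_unitCube, ENNReal.one_rpow, mul_one]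
          _ ≤ ((A + 1) * ((ENNReal.ofReal (2 * (2 * δ)) ^ d * ∫⁻ y, f y) ^ ((n : ℝ) / d)) ^
                ((2 * n : ℝ) / (2 * n - 1))) ^ t := by
              refine ENNReal.rpow_le_rpow ?_ ht0.le
              refine (setLIntegral_le_lintegral _ _).trans (hNint.trans ?_)
              refine mul_le_mul' le_self_add (ENNReal.rpow_le_rpow hGint (by positivity))
          _ = _ := by
              rw [ENNReal.mul_rpow_of_nonneg _ _ ht0.le, ← ENNReal.rpow_mul, ← ENNReal.rpow_mul]
              congr 1
              conv_rhs => rw [← ENNReal.rpow_one (_ * _)]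
              congr 1
              have h2n0 : 2 * (n : ℝ) - 1 ≠ 0 := h2n.ne'
              rw [ht]; field_simp
              exact div_self (by linarith)
    _ = K ^ ((d : ℝ) / (2 * n)) * ENNReal.ofReal (2 * (2 * δ)) ^ d * (A + 1) ^ t *
          ∫⁻ y, f y := by ring
    _ = _ := by rw [hKD]; ring

theorem lintegral_eq_tsum_unitCube {n : ℕ} (F : (Fin n → ℝ) → ℝ≥0∞) :
    ∫⁻ x, F x = ∑' m : Fin n → ℤ, ∫⁻ x in unitCube (fun i => (m i : ℝ)), F x := by
  have hmem : ∀ (x : Fin n → ℝ) (m : Fin n → ℤ),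
      x ∈ unitCube (fun i => (m i : ℝ)) ↔ ∀ i, ⌊x i⌋ = m i := by
    intro x m
    simp [unitCube, Int.floor_eq_iff]
  have hU : ⋃ m : Fin n → ℤ, unitCube (fun i => (m i : ℝ)) = univ := by
    ext x
    simp only [mem_iUnion, hmem, mem_univ, iff_true]
    exact ⟨fun i => ⌊x i⌋, fun _ => rfl⟩
  rw [← setLIntegral_univ, ← hU, lintegral_iUnion (fun _ => measurableSet_unitCube _)]
  intro m m' hmm
  refine Set.disjoint_left.2 fun x hx hx' => hmm ?_
  rw [hmem] at hx hx'
  funext i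
  rw [← hx i, hx' i]

/-- Bounded overlap: each `y` lies in at most `10 ^ n` of these balls. -/
theorem tsum_setLIntegral_ball_le {n : ℕ} {g : (Fin n → ℝ) → ℝ≥0∞} (hg : Measurable g) :
    ∑' m : Fin n → ℤ, ∫⁻ y in Metric.ball (fun i => (m i : ℝ)) 4, g y ≤
      10 ^ n * ∫⁻ y, g y := by
  simp_rw [← lintegral_indicator Metric.isOpen_ball.measurableSet]
  rw [← lintegral_tsum fun m =>
    (hg.indicator Metric.isOpen_ball.measurableSet).aemeasurable, ← lintegral_const_mul _ hg]
  refine lintegral_mono fun y => ?_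
  set S : Finset (Fin n → ℤ) := Fintype.piFinset fun i => Finset.Icc (⌊y i⌋ - 4) (⌊y i⌋ + 5)
    with hS
  have hcard : S.card = 10 ^ n := by
    rw [hS, Fintype.card_piFinset]
    simp only [Int.card_Icc]
    rw [Finset.prod_congr rfl (g := fun _ => 10) fun i _ => by omega]
    simp
  rw [tsum_eq_sum (s := S)]
  · calc ∑ m ∈ S, (Metric.ball (fun i => (m i : ℝ)) 4).indicator g y ≤ ∑ m ∈ S, g y :=
          Finset.sum_le_sum fun m _ => indicator_le_self _ _ _
      _ = 10 ^ n * g y := by rw [Finset.sum_const, hcard, nsmul_eq_mul]; push_cast; rfl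
  · intro m hm
    refine indicator_of_notMem (fun hy => hm ?_) _
    rw [hS, Fintype.mem_piFinset]
    intro i
    have h := (dist_le_pi_dist y (fun i => (m i : ℝ)) i).trans_lt hy
    rw [Real.dist_eq, abs_sub_lt_iff] at h
    have h1 := Int.floor_le (y i)
    have h2 := Int.lt_floor_add_one (y i)
    rw [Finset.mem_Icc]
    constructor
    · have : ((⌊y i⌋ - 4 : ℤ) : ℝ) ≤ m i := by push_cast; linarith [h.1]
      exact_mod_cast this
    · have : (m i : ℝ) ≤ ((⌊y i⌋ + 5 : ℤ) : ℝ) := by push_cast; linarith [h.2]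
      exact_mod_cast this

/-- The `L¹` estimate. -/
theorem exists_lintegral_nbhdMaximal_le {n k : ℕ} (hkn : k < n) :
    ∃ C : ℝ≥0∞, C ≠ ∞ ∧ ∀ δ : ℝ, 0 < δ → δ < 1 → ∀ g : (Fin n → ℝ) → ℝ≥0∞,
      Measurable g → ∫⁻ x, nbhdMaximal n k δ g x ≤
        C * ENNReal.ofReal (δ ^ (((k : ℝ) - n) / (2 * n))) * ∫⁻ y, g y := by
  obtain ⟨C, hC, hloc⟩ := exists_setLIntegral_nbhdMaximal_le hkn
  refine ⟨C * 10 ^ n, ENNReal.mul_ne_top hC (by finiteness), fun δ hδ hδ1 g hg => ?_⟩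
  rw [lintegral_eq_tsum_unitCube]
  refine (ENNReal.tsum_le_tsum fun m => hloc δ hδ hδ1 g hg _).trans ?_
  rw [ENNReal.tsum_mul_left]
  refine (mul_le_mul_right (tsum_setLIntegral_ball_le hg) _).trans_eq ?_
  ring

/-! ### From `L¹` to `L^p` -/

/-- Jensen's inequality for averages. -/
theorem div_rpow_le_lintegral_rpow_div {α : Type*} [MeasurableSpace α] {μ : Measure α}
    {f : α → ℝ≥0∞} (hf : AEMeasurable f μ) {p : ℝ} (hp : 1 ≤ p) (h0 : μ univ ≠ 0)
    (htop : μ univ ≠ ∞) :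
    ((∫⁻ x, f x ∂μ) / μ univ) ^ p ≤ (∫⁻ x, f x ^ p ∂μ) / μ univ := by
  have hp0 : 0 < p := by linarith
  have h := lintegral_rpow_le_rpow_mul (hf.pow_const p) (t := p⁻¹) (by positivity)
    (inv_le_one_of_one_le₀ hp)
  simp_rw [← ENNReal.rpow_mul, mul_inv_cancel₀ hp0.ne', ENNReal.rpow_one] at h
  rw [ENNReal.div_rpow_of_nonneg _ _ hp0.le]
  refine ENNReal.div_le_of_le_mul ?_
  refine (ENNReal.rpow_le_rpow h hp0.le).trans_eq ?_
  rw [ENNReal.mul_rpow_of_nonneg _ _ hp0.le, ← ENNReal.rpow_mul, ← ENNReal.rpow_mul,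
    inv_mul_cancel₀ hp0.ne', ENNReal.rpow_one, sub_mul, inv_mul_cancel₀ hp0.ne', one_mul,
    ENNReal.rpow_sub _ _ h0 htop, ENNReal.rpow_one, div_eq_mul_inv, div_eq_mul_inv]
  ring

theorem nbhdMaximal_rpow_le_nbhdMaximal {n k : ℕ} {δ : ℝ} (hδ : 0 < δ)
    {g : (Fin n → ℝ) → ℝ≥0∞} (hg : Measurable g) {p : ℝ} (hp : 1 ≤ p) (x : Fin n → ℝ) :
    nbhdMaximal n k δ g x ^ p ≤ nbhdMaximal n k δ (fun y => g y ^ p) x := by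
  have hp0 : 0 < p := by linarith
  rw [← ENNReal.le_rpow_inv_iff hp0]
  refine iSup₂_le fun r hr => ?_
  rw [ENNReal.le_rpow_inv_iff hp0]
  refine le_trans (le_iInf fun j => ?_) (le_iSup₂_of_le r hr le_rfl)
  refine (ENNReal.rpow_le_rpow (iInf_le _ j) hp0.le).trans ?_
  have := div_rpow_le_lintegral_rpow_div (μ := volume.restrict (faceNbhd δ j x r))
    hg.aemeasurable hp
  rw [Measure.restrict_apply_univ] at this
  exact this ((pos_iff_ne_zero.2 (pow_ne_zero _ (by simpa using hδ))).trans_le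
    (pow_le_volume_faceNbhd hδ hr.1 j x)).ne'
    (volume_faceNbhd_ne_top hδ (by linarith [hr.1]) j x)

theorem exists_skeletonMaximalNorm_le {n k : ℕ} (hkn : k < n) :
    ∃ C : ℝ, 0 < C ∧ ∀ p : ℝ, 1 ≤ p → ∀ δ : ℝ, 0 < δ → δ < 1 →
      skeletonMaximalNorm n k δ (ENNReal.ofReal p) ≤
        ENNReal.ofReal (C * δ ^ (((k : ℝ) - (n : ℝ)) / (2 * (n : ℝ) * p))) := by
  obtain ⟨C, hC, hL⟩ := exists_lintegral_nbhdMaximal_le hkn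
  -- A constant at least `1` dominates its own `1/p`-th power, making the bound uniform in `p`.
  refine ⟨max C.toReal 1, by positivity, fun p hp δ hδ hδ1 => ?_⟩
  have hp0 : 0 < p := by linarith
  refine iSup_le fun f => iSup₂_le fun hf hf0 => ?_
  have hpne : ENNReal.ofReal p ≠ 0 := by simpa using hp0
  set g : (Fin n → ℝ) → ℝ≥0∞ := fun y => ‖hf.1.mk f y‖ₑ with hg
  have hgm : Measurable g := hf.1.stronglyMeasurable_mk.enorm
  have hfg : skeletonMaximal n k δ f = nbhdMaximal n k δ g := by
    funext x
    unfold skeletonMaximal nbhdMaximal faceAverage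
    congr! 6 with r hr j
    refine lintegral_congr_ae (ae_restrict_of_ae ?_)
    filter_upwards [hf.1.ae_eq_mk] with y hy
    rw [hg, hy]
  have hfin : eLpNorm f (ENNReal.ofReal p) volume = (∫⁻ y, g y ^ p) ^ p⁻¹ := by
    rw [eLpNorm_eq_lintegral_rpow_enorm_toReal hpne ENNReal.ofReal_ne_top,
      ENNReal.toReal_ofReal hp0.le, one_div]
    congr 1
    refine lintegral_congr_ae ?_
    filter_upwards [hf.1.ae_eq_mk] with y hy
    rw [hg, hy]
  refine ENNReal.div_le_of_le_mul ?_
  rw [eLpNorm_eq_lintegral_rpow_enorm_toReal hpne ENNReal.ofReal_ne_top,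
      ENNReal.toReal_ofReal hp0.le, one_div, hfg, hfin]
  simp only [enorm_eq_self]
  have hpint : ∫⁻ x, nbhdMaximal n k δ g x ^ p ≤
      C * ENNReal.ofReal (δ ^ (((k : ℝ) - n) / (2 * n))) * ∫⁻ y, g y ^ p :=
    (lintegral_mono fun x => nbhdMaximal_rpow_le_nbhdMaximal hδ hgm hp x).trans
      (hL δ hδ hδ1 _ (hgm.pow_const p))
  refine (ENNReal.rpow_le_rpow hpint (by positivity)).trans ?_
  rw [ENNReal.mul_rpow_of_nonneg _ _ (by positivity : 0 ≤ p⁻¹)]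
  gcongr
  rw [ENNReal.mul_rpow_of_nonneg _ _ (by positivity : 0 ≤ p⁻¹),
    ENNReal.ofReal_rpow_of_pos (by positivity), ← Real.rpow_mul hδ.le,
    ENNReal.ofReal_mul (by positivity)]
  have hexp : ((k : ℝ) - n) / (2 * n) * p⁻¹ = ((k : ℝ) - n) / (2 * n * p) := by
    rw [← div_eq_mul_inv, div_div]
  rw [hexp]
  gcongr
  have h1 : C ≤ ENNReal.ofReal (max C.toReal 1) := by
    conv_lhs => rw [← ENNReal.ofReal_toReal hC]
    exact ENNReal.ofReal_le_ofReal (le_max_left _ _)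
  have h2 : 1 ≤ ENNReal.ofReal (max C.toReal 1) := by
    rw [ENNReal.one_le_ofReal]; exact le_max_right _ _
  calc C ^ p⁻¹ ≤ ENNReal.ofReal (max C.toReal 1) ^ p⁻¹ :=
        ENNReal.rpow_le_rpow h1 (by positivity)
    _ ≤ ENNReal.ofReal (max C.toReal 1) ^ (1 : ℝ) :=
        ENNReal.rpow_le_rpow_of_exponent_le h2 (inv_le_one_of_one_le₀ hp)
    _ = _ := ENNReal.rpow_one _

/-! ### Lower bound: a small set containing many skeletons -/

/-- A radius in `[1, 2]` meeting prescribed lattice conditions at successively finer scales. -/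
theorem exists_radius_near_lattices {b : ℝ} (hb0 : 0 < b) (hb1 : b ≤ 1) (y ε : ℕ → ℝ)
    (hε : ∀ l, ε l = 1 ∨ ε l = -1) (L : ℕ) :
    ∃ u : ℝ, 1 ≤ u ∧ u + b ^ L ≤ 2 ∧ ∀ l < L, ∀ r ∈ Icc u (u + b ^ L),
      ∃ m : ℤ, |y l + ε l * r - m * b ^ l| ≤ b ^ (l + 1) := by
  induction L with
  | zero => exact ⟨1, le_rfl, by norm_num, by simp⟩
  | succ L ih =>
    obtain ⟨u, hu1, hu2, hu⟩ := ih
    have hbL : 0 < b ^ L := by positivity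
    have hbL1 : b ^ (L + 1) ≤ b ^ L := pow_le_pow_of_le_one hb0.le hb1 (Nat.le_succ L)
    -- An interval of length `b ^ L` meets every translate of `b ^ L ℤ`.
    obtain ⟨r₀, m₀, hr₀, hr₀', hm₀⟩ : ∃ (r₀ : ℝ) (m₀ : ℤ), u ≤ r₀ ∧ r₀ ≤ u + b ^ L ∧
        y L + ε L * r₀ = m₀ * b ^ L := by
      rcases hε L with h | h
      · refine ⟨⌈(y L + u) / b ^ L⌉ * b ^ L - y L, ⌈(y L + u) / b ^ L⌉, ?_, ?_, by rw [h]; ring⟩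
        · have := (div_le_iff₀ hbL).1 (Int.le_ceil ((y L + u) / b ^ L))
          linarith
        · have h1 := (Int.ceil_lt_add_one ((y L + u) / b ^ L)).le
          have h2 := mul_le_mul_of_nonneg_right h1 hbL.le
          rw [add_mul, div_mul_cancel₀ _ hbL.ne'] at h2
          linarith
      · refine ⟨y L - ⌊(y L - u) / b ^ L⌋ * b ^ L, ⌊(y L - u) / b ^ L⌋, ?_, ?_, by rw [h]; ring⟩
        · have := (le_div_iff₀ hbL).1 (Int.floor_le ((y L - u) / b ^ L))
          linarith
        · have h1 := (Int.lt_floor_add_one ((y L - u) / b ^ L)).le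
          have h2 := mul_le_mul_of_nonneg_right h1 hbL.le
          rw [add_mul, div_mul_cancel₀ _ hbL.ne'] at h2
          linarith
    -- The left end is pushed back if necessary, so that the new interval of length `b ^ (L + 1)`
    -- contains `r₀` and stays inside the old one.
    have hmin1 := min_le_left r₀ (u + b ^ L - b ^ (L + 1))
    have hmin2 := min_le_right r₀ (u + b ^ L - b ^ (L + 1))
    have hmin3 : u ≤ min r₀ (u + b ^ L - b ^ (L + 1)) := le_min hr₀ (by linarith)
    have hmin4 : r₀ ≤ min r₀ (u + b ^ L - b ^ (L + 1)) + b ^ (L + 1) := by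
      rcases min_cases r₀ (u + b ^ L - b ^ (L + 1)) with h | h <;> rw [h.1]
      · linarith [pow_pos hb0 (L + 1)]
      · linarith
    refine ⟨min r₀ (u + b ^ L - b ^ (L + 1)), by linarith, by linarith, fun l hl r hr => ?_⟩
    rcases Nat.lt_succ_iff_lt_or_eq.1 hl with h | rfl
    · exact hu l h r ⟨by linarith [hr.1], by linarith [hr.2]⟩
    · refine ⟨m₀, ?_⟩
      have h1 : y l + ε l * r - m₀ * b ^ l = ε l * (r - r₀) := by rw [← hm₀]; ring
      have h2 : |ε l| = 1 := by rcases hε l with h | h <;> simp [h]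
      rw [h1, abs_mul, h2, one_mul, abs_le]
      constructor <;> linarith [hr.1, hr.2]

/-- Points of a bounded interval which are close to a lattice `b ^ l ℤ`, relative to the next
finer scale `b ^ (l + 1)`, for some `l < L`. -/
def comb (b : ℝ) (L : ℕ) : Set ℝ :=
  ⋃ l ∈ Finset.range L, ⋃ m ∈ Finset.Icc (-⌊7 / b ^ l⌋) ⌊7 / b ^ l⌋,
    Icc ((m : ℝ) * b ^ l - 2 * b ^ (l + 1)) (m * b ^ l + 2 * b ^ (l + 1))

theorem measurableSet_comb (b : ℝ) (L : ℕ) : MeasurableSet (comb b L) :=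
  Finset.measurableSet_biUnion _ fun _ _ => Finset.measurableSet_biUnion _ fun _ _ =>
    measurableSet_Icc

/-- The cut-off `7` in `comb` loses nothing here: `|m * b ^ l| ≤ 5 + 2`. -/
theorem mem_comb {b : ℝ} (hb0 : 0 < b) (hb1 : b ≤ 1) {L l : ℕ} (hl : l < L) {a : ℝ}
    (ha : |a| ≤ 5) {m : ℤ} (h : |a - m * b ^ l| ≤ 2 * b ^ (l + 1)) : a ∈ comb b L := by
  have hbl : 0 < b ^ l := by positivity
  have hbl1 : b ^ (l + 1) ≤ 1 := pow_le_one₀ hb0.le hb1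
  have ha' := abs_le.1 ha
  have h' := abs_le.1 h
  simp only [comb, mem_iUnion, Finset.mem_range, Finset.mem_Icc]
  refine ⟨l, hl, m, ⟨?_, ?_⟩, by linarith, by linarith⟩
  · rw [neg_le, Int.le_floor, le_div_iff₀ hbl]
    push_cast
    linarith
  · rw [Int.le_floor, le_div_iff₀ hbl]
    linarith

/-- Each scale has `O(b ^ (-l))` intervals of length `4 * b ^ (l + 1)`, hence measure `O(b)`
whatever `l` is. -/
theorem volume_comb_le {b : ℝ} (hb0 : 0 < b) (hb1 : b ≤ 1) (L : ℕ) :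
    volume (comb b L) ≤ ENNReal.ofReal (60 * L * b) := by
  have hone : ∀ l, volume (⋃ m ∈ Finset.Icc (-⌊7 / b ^ l⌋) ⌊7 / b ^ l⌋,
      Icc ((m : ℝ) * b ^ l - 2 * b ^ (l + 1)) (m * b ^ l + 2 * b ^ (l + 1))) ≤
      ENNReal.ofReal (60 * b) := by
    intro l
    have hbl : 0 < b ^ l := by positivity
    have hbl1 : b ^ l ≤ 1 := pow_le_one₀ hb0.le hb1
    refine (measure_biUnion_finset_le _ _).trans ?_
    have : ∀ m : ℤ, volume (Icc ((m : ℝ) * b ^ l - 2 * b ^ (l + 1))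
        (m * b ^ l + 2 * b ^ (l + 1))) = ENNReal.ofReal (4 * b ^ (l + 1)) := by
      intro m; rw [Real.volume_Icc]; congr 1; ring
    simp_rw [this]
    rw [Finset.sum_const, nsmul_eq_mul, Int.card_Icc, ← ENNReal.ofReal_natCast,
      ← ENNReal.ofReal_mul (by positivity)]
    apply ENNReal.ofReal_le_ofReal
    have h0 : 0 ≤ ⌊7 / b ^ l⌋ := Int.floor_nonneg.2 (by positivity)
    have h1 : ((⌊7 / b ^ l⌋ + 1 - -⌊7 / b ^ l⌋).toNat : ℝ) ≤ 15 / b ^ l := by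
      have e : (((⌊7 / b ^ l⌋ + 1 - -⌊7 / b ^ l⌋).toNat : ℤ) : ℝ) = 2 * ⌊7 / b ^ l⌋ + 1 := by
        rw [Int.toNat_of_nonneg (by omega)]; push_cast; ring
      rw [Int.cast_natCast] at e
      rw [e]
      have h2 := Int.floor_le (7 / b ^ l)
      have h3 : 1 ≤ 1 / b ^ l := by rw [le_div_iff₀ hbl]; linarith
      have h4 : 15 / b ^ l = 2 * (7 / b ^ l) + 1 / b ^ l := by ring
      linarith
    calc ((⌊7 / b ^ l⌋ + 1 - -⌊7 / b ^ l⌋).toNat : ℝ) * (4 * b ^ (l + 1))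
        ≤ 15 / b ^ l * (4 * b ^ (l + 1)) := by gcongr
      _ = 60 * b := by field_simp; ring
  refine (measure_biUnion_finset_le _ _).trans ((Finset.sum_le_sum fun l _ => hone l).trans_eq ?_)
  rw [Finset.sum_const, Finset.card_range, nsmul_eq_mul, ← ENNReal.ofReal_natCast,
    ← ENNReal.ofReal_mul (by positivity)]
  congr 1; ring

/-- A small bounded set containing neighbourhoods of the `k`-skeletons of cubes around every point
of the unit cube. -/
def skeletonSet (n k : ℕ) (b : ℝ) : Set (Fin n → ℝ) :=
  ⋃ J ∈ Finset.univ.filter (fun J : Finset (Fin n) => J.card = n - k),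
    Set.univ.pi fun i => if i ∈ J then comb b (2 * n) else Icc (-5) 5

theorem measurableSet_skeletonSet (n k : ℕ) (b : ℝ) : MeasurableSet (skeletonSet n k b) :=
  Finset.measurableSet_biUnion _ fun J _ => MeasurableSet.univ_pi fun i => by
    split_ifs
    · exact measurableSet_comb _ _
    · exact measurableSet_Icc

theorem volume_skeletonSet_le (n k : ℕ) {b : ℝ} (hb0 : 0 < b) (hb1 : b ≤ 1) :
    volume (skeletonSet n k b) ≤
      ENNReal.ofReal (2 ^ n * ((120 * n) ^ (n - k) * 10 ^ n) * b ^ (n - k)) := by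
  have hone : ∀ J ∈ Finset.univ.filter (fun J : Finset (Fin n) => J.card = n - k),
      volume (Set.univ.pi fun i => if i ∈ J then comb b (2 * n) else Icc (-5) 5) ≤
        ENNReal.ofReal ((120 * n) ^ (n - k) * 10 ^ n * b ^ (n - k)) := by
    intro J hJ
    have hJ' : J.card = n - k := by simpa using hJ
    rw [volume_pi_pi]
    calc ∏ i, volume (if i ∈ J then comb b (2 * n) else Icc (-5) 5)
        ≤ ∏ i : Fin n, ((if i ∈ J then ENNReal.ofReal (120 * n * b) else 1) *
            ENNReal.ofReal 10) := by
          refine Finset.prod_le_prod' fun i _ => ?_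
          split_ifs
          · refine (volume_comb_le hb0 hb1 (2 * n)).trans ?_
            rw [← ENNReal.ofReal_mul (by positivity)]
            apply ENNReal.ofReal_le_ofReal
            push_cast
            have : 0 ≤ n * b := by positivity
            linarith
          · rw [Real.volume_Icc, one_mul]
            norm_num
      _ = _ := by
          rw [Finset.prod_mul_distrib, Finset.prod_const, Finset.card_univ, Fintype.card_fin,
            Finset.prod_ite_mem, Finset.univ_inter, Finset.prod_const, hJ',
            ← ENNReal.ofReal_pow (by positivity), ← ENNReal.ofReal_pow (by positivity),
            ← ENNReal.ofReal_mul (by positivity)]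
          congr 1; rw [mul_pow]; ring
  refine (measure_biUnion_finset_le _ _).trans ((Finset.sum_le_sum hone).trans ?_)
  rw [Finset.sum_const, nsmul_eq_mul, ← ENNReal.ofReal_natCast, ← ENNReal.ofReal_mul (by positivity)]
  apply ENNReal.ofReal_le_ofReal
  rw [mul_assoc (2 ^ n)]
  gcongr
  have := Finset.card_filter_le (Finset.univ : Finset (Finset (Fin n))) fun J => J.card = n - k
  rw [Finset.card_univ, Fintype.card_finset, Fintype.card_fin] at this
  exact_mod_cast this

theorem exists_faceNbhd_subset_skeletonSet {n k : ℕ} {b : ℝ} (hb0 : 0 < b) (hb1 : b < 1)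
    {x : Fin n → ℝ} (hx : x ∈ unitCube 0) :
    ∃ r ∈ Icc (1 : ℝ) 2, ∀ j : FaceIndex n k,
      faceNbhd (b ^ (2 * n)) j x r ⊆ skeletonSet n k b := by
  have hδ : 0 < b ^ (2 * n) := by positivity
  have hδ1 : b ^ (2 * n) ≤ 1 := pow_le_one₀ hb0.le hb1.le
  -- Scale `2 * i` handles `x i + r` and scale `2 * i + 1` handles `x i - r`.
  obtain ⟨r, hr1, hr2, hr⟩ := exists_radius_near_lattices hb0 hb1.le
    (fun l => if h : l / 2 < n then x ⟨l / 2, h⟩ else 0) (fun l => if l % 2 = 0 then 1 else -1)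
    (fun l => by split_ifs <;> simp) (2 * n)
  have hr2' : r ≤ 2 := by linarith
  have hlat : ∀ (i : Fin n) (s : SignType), s ≠ 0 →
      ∃ l < 2 * n, ∃ m : ℤ, |x i + (s : ℝ) * r - m * b ^ l| ≤ b ^ (l + 1) := by
    intro i s hs
    have hrr : r ∈ Icc r (r + b ^ (2 * n)) := ⟨le_rfl, by linarith⟩
    have hi := i.2
    rcases s with _ | _ | _
    · exact absurd rfl hs
    · obtain ⟨m, hm⟩ := hr (2 * i + 1) (by omega) r hrr
      refine ⟨2 * i + 1, by omega, m, ?_⟩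
      have h1 : (2 * (i : ℕ) + 1) / 2 = i := by omega
      have h2 : (2 * (i : ℕ) + 1) % 2 = 1 := by omega
      simpa [h1, h2] using hm
    · obtain ⟨m, hm⟩ := hr (2 * i) (by omega) r hrr
      refine ⟨2 * i, by omega, m, ?_⟩
      simpa using hm
  refine ⟨r, ⟨hr1, hr2'⟩, fun j y hy => ?_⟩
  rw [faceNbhd_eq_pi hδ (by linarith), Set.mem_univ_pi] at hy
  simp only [skeletonSet, mem_iUnion, Finset.mem_filter, Finset.mem_univ, true_and]
  refine ⟨Finset.univ.filter fun i => j.1 i ≠ 0, j.card_ne_zero, Set.mem_univ_pi.2 fun i => ?_⟩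
  have h := hy i
  have hxi := hx i (mem_univ i)
  simp only [Pi.zero_apply, zero_add, mem_Ico] at hxi
  by_cases hi : j.1 i = 0
  · rw [if_pos hi] at h
    rw [if_neg (by simp [hi])]
    constructor <;> linarith [h.1, h.2, hxi.1, hxi.2]
  · rw [if_neg hi] at h
    rw [if_pos (by simp [hi])]
    obtain ⟨l, hl, m, hm⟩ := hlat i (j.1 i) hi
    have hs : |((j.1 i : SignType) : ℝ) * r| ≤ 2 := by
      rw [abs_mul, abs_of_nonneg (by linarith : 0 ≤ r)]
      rcases h : j.1 i with _ | _ | _ <;> simp_all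
    have hs' := abs_le.1 hs
    have hm' := abs_le.1 hm
    -- The neighbourhood width is at most the lattice error at every scale used; together they give
    -- the `2 * b ^ (l + 1)` of `comb`.
    have hbl : b ^ (2 * n) ≤ b ^ (l + 1) := pow_le_pow_of_le_one hb0.le hb1.le hl
    refine mem_comb hb0 hb1.le hl (m := m) ?_ ?_
    · rw [abs_le]; constructor <;> linarith [h.1, h.2, hxi.1, hxi.2, hs'.1, hs'.2]
    · rw [abs_le]; constructor <;> linarith [h.1, h.2, hm'.1, hm'.2]

theorem exists_le_skeletonMaximalNorm {n k : ℕ} (hkn : k < n) :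
    ∃ c : ℝ, 0 < c ∧ ∀ p : ℝ, 1 ≤ p → ∀ δ : ℝ, 0 < δ → δ < 1 →
      ENNReal.ofReal (c * δ ^ (((k : ℝ) - (n : ℝ)) / (2 * (n : ℝ) * p))) ≤
        skeletonMaximalNorm n k δ (ENNReal.ofReal p) := by
  have hn : 0 < n := by omega
  have hnR : (0 : ℝ) < n := by exact_mod_cast hn
  set V : ℝ := max (2 ^ n * ((120 * n) ^ (n - k) * 10 ^ n)) 1 with hV
  have hV1 : 1 ≤ V := le_max_right _ _
  have hV0 : 0 < V := by linarith
  refine ⟨V⁻¹, by positivity, fun p hp δ hδ hδ1 => ?_⟩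
  have hp0 : 0 < p := by linarith
  have hpne : ENNReal.ofReal p ≠ 0 := by simpa using hp0
  set b : ℝ := δ ^ ((1 : ℝ) / (2 * n)) with hb
  have hb0 : 0 < b := by positivity
  have hb1 : b < 1 := Real.rpow_lt_one hδ.le hδ1 (by positivity)
  have hbδ : b ^ (2 * n) = δ := by
    rw [hb, ← Real.rpow_natCast, ← Real.rpow_mul hδ.le]
    push_cast
    rw [one_div_mul_cancel (by positivity), Real.rpow_one]
  set E := skeletonSet n k b with hE
  have hEm : MeasurableSet E := measurableSet_skeletonSet n k b
  have hEvol : volume E ≤ ENNReal.ofReal (V * b ^ (n - k)) :=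
    (volume_skeletonSet_le n k hb0 hb1.le).trans (ENNReal.ofReal_le_ofReal (by
      gcongr; exact le_max_left _ _))
  have hEtop : volume E ≠ ∞ := ne_top_of_le_ne_top ENNReal.ofReal_ne_top hEvol
  have hcover : ∀ x ∈ unitCube (0 : Fin n → ℝ), ∃ r ∈ Icc (1 : ℝ) 2, ∀ j : FaceIndex n k,
      faceNbhd δ j x r ⊆ E := by
    intro x hx
    have := exists_faceNbhd_subset_skeletonSet (k := k) hb0 hb1 hx
    rwa [hbδ] at this
  have hpos : ∀ {r : ℝ}, r ∈ Icc (1 : ℝ) 2 → ∀ (j : FaceIndex n k) (x : Fin n → ℝ),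
      volume (faceNbhd δ j x r) ≠ 0 := fun hr j x =>
    ((pos_iff_ne_zero.2 (pow_ne_zero _ (by simpa using hδ))).trans_le
      (pow_le_volume_faceNbhd hδ hr.1 j x)).ne'
  have hE0 : volume E ≠ 0 := by
    obtain ⟨r, hr, hsub⟩ := hcover 0 (by simp [unitCube])
    obtain ⟨J, hJ⟩ : ∃ J : Finset (Fin n), J.card = n - k := by
      obtain ⟨J, -, hJ⟩ := Finset.exists_subset_card_eq (s := (Finset.univ : Finset (Fin n)))
        (n := n - k) (by simp)
      exact ⟨J, hJ⟩
    let j : FaceIndex n k := faceOfSigns J hJ hkn (fun _ => 1) (by simp)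
    exact fun h => hpos hr j 0 (measure_mono_null (hsub j) h)
  set f : (Fin n → ℝ) → ℝ := E.indicator fun _ => 1 with hf
  have hfLp : MemLp f (ENNReal.ofReal p) volume :=
    memLp_indicator_const _ hEm _ (Or.inr hEtop)
  have hfnorm : eLpNorm f (ENNReal.ofReal p) volume = volume E ^ p⁻¹ := by
    rw [hf, eLpNorm_indicator_const hEm hpne ENNReal.ofReal_ne_top,
      ENNReal.toReal_ofReal hp0.le]
    simp
  have hM : ∀ x ∈ unitCube (0 : Fin n → ℝ), 1 ≤ skeletonMaximal n k δ f x := by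
    intro x hx
    obtain ⟨r, hr, hsub⟩ := hcover x hx
    refine le_iSup₂_of_le r hr (le_iInf fun j => ?_)
    unfold faceAverage
    rw [setLIntegral_congr_fun (g := fun _ => 1) (isOpen_faceNbhd _ _ _ _).measurableSet
      fun y hy => by simp [hf, hsub j hy], setLIntegral_const, one_mul,
      ENNReal.div_self (hpos hr j x) (volume_faceNbhd_ne_top hδ (by linarith [hr.1]) j x)]
  have hMnorm : 1 ≤ eLpNorm (skeletonMaximal n k δ f) (ENNReal.ofReal p) volume := by
    rw [eLpNorm_eq_lintegral_rpow_enorm_toReal hpne ENNReal.ofReal_ne_top,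
      ENNReal.toReal_ofReal hp0.le]
    apply ENNReal.one_le_rpow _ (by positivity)
    calc (1 : ℝ≥0∞) = ∫⁻ x in unitCube (0 : Fin n → ℝ), 1 := by
          rw [setLIntegral_const, volume_unitCube, one_mul]
      _ ≤ ∫⁻ x in unitCube (0 : Fin n → ℝ), ‖skeletonMaximal n k δ f x‖ₑ ^ p :=
          setLIntegral_mono' (measurableSet_unitCube _) fun x hx =>
            ENNReal.one_le_rpow (hM x hx) hp0
      _ ≤ _ := setLIntegral_le_lintegral _ _
  have hfne : eLpNorm f (ENNReal.ofReal p) volume ≠ 0 := by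
    rw [hfnorm]
    simp [ENNReal.rpow_eq_zero_iff, hE0, hEtop]
  refine le_trans ?_ (le_iSup_of_le f (le_iSup₂_of_le hfLp hfne le_rfl))
  -- The maximal function of the indicator is at least `1` on a set of measure `1`.
  have hquot : (volume E ^ p⁻¹)⁻¹ ≤ eLpNorm (skeletonMaximal n k δ f) (ENNReal.ofReal p) volume /
      eLpNorm f (ENNReal.ofReal p) volume := by
    rw [hfnorm, ← one_div]
    gcongr
  refine le_trans ?_ hquot
  have hdcast : ((n - k : ℕ) : ℝ) = n - k := Nat.cast_sub hkn.le
  have hVE : volume E ^ p⁻¹ ≤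
      ENNReal.ofReal (V * δ ^ (((n : ℝ) - k) / (2 * (n : ℝ) * p))) := by
    refine (ENNReal.rpow_le_rpow hEvol (by positivity)).trans ?_
    rw [ENNReal.ofReal_rpow_of_pos (by positivity), Real.mul_rpow hV0.le (by positivity)]
    apply ENNReal.ofReal_le_ofReal
    have h1 : (b ^ (n - k)) ^ p⁻¹ = δ ^ (((n : ℝ) - k) / (2 * (n : ℝ) * p)) := by
      rw [hb, ← Real.rpow_natCast, ← Real.rpow_mul hδ.le, ← Real.rpow_mul hδ.le, hdcast]
      congr 1
      field_simp
    rw [h1]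
    gcongr
    exact Real.rpow_le_self_of_one_le hV1 (inv_le_one_of_one_le₀ hp)
  refine le_trans (le_of_eq ?_) (ENNReal.inv_le_inv.2 hVE)
  rw [← ENNReal.ofReal_inv_of_pos (by positivity), mul_inv, ← Real.rpow_neg hδ.le]
  congr 3
  rw [← neg_div, neg_sub]

end SkeletonMaximal

theorem theorem1 (n k : ℕ) (hkn : k < n) :
    (∀ ε : ℝ, 0 < ε → ∃ C' : ℝ, 0 < C' ∧ ∀ p : ℝ, 1 ≤ p → ∀ δ : ℝ, 0 < δ → δ < 1 →
      ENNReal.ofReal (C' * δ ^ (((k : ℝ) - (n : ℝ)) / (2 * (n : ℝ) * p) + ε)) ≤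
        SkeletonMaximal.skeletonMaximalNorm n k δ (ENNReal.ofReal p)) ∧
    (∃ C : ℝ, 0 < C ∧ ∀ p : ℝ, 1 ≤ p → ∀ δ : ℝ, 0 < δ → δ < 1 →
      SkeletonMaximal.skeletonMaximalNorm n k δ (ENNReal.ofReal p) ≤
        ENNReal.ofReal (C * δ ^ (((k : ℝ) - (n : ℝ)) / (2 * (n : ℝ) * p)))) := by
  refine ⟨fun ε hε => ?_, SkeletonMaximal.exists_skeletonMaximalNorm_le hkn⟩
  obtain ⟨c, hc, h⟩ := SkeletonMaximal.exists_le_skeletonMaximalNorm hkn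
  refine ⟨c, hc, fun p hp δ hδ hδ1 => le_trans (ENNReal.ofReal_le_ofReal ?_) (h p hp δ hδ hδ1)⟩
  gcongr ?_ * ?_
  -- The construction has no `ε`-loss; since `δ < 1`, the extra `ε` only weakens the bound.
  exact Real.rpow_le_rpow_of_exponent_ge hδ hδ1.le (by linarith)
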